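/- Let $d\ge 3$. For $t>0$, $x,y\in\mathbb R^d$ let $g(t,x,y)=(4\pi t)^{-d/2}e^{-|y-x|^2/(4t)}$ be the Gaussian kernel. Let $V\colon\mathbb R^d\to\mathbb R$ be Borel measurable with $V\le 0$. A *fundamental solution* of $\partial_t=\Delta+V$ is a Borel function $G\colon(0,\infty)\times\mathbb R^d\times\mathbb R^d\to\mathbb R$ satisfying the Duhamel formula $$G(t,x,y)=g(t,x,y)+\int_0^t\int_{\mathbb R^d}G(s,x,z)\,V(z)\,g(t-s,z,y)\,dz\,ds,\qquad t>0,\ x,y\in\mathbb R^d,$$ with an absolutely convergent double integral. We say that $G$ has *sharp global Gaussian bounds* if there are numbers $0<c_1\le 1\le c_2$ such that $$c_1\le\frac{G(t,x,y)}{g(t,x,y)}\le c_2,\qquad t>0,\ x,y\in\mathbb R^d.$$ Define $$K(x,y)=\frac{e^{-(|x||y|-x\cdot y)/2}}{|x|^{d-2}}\,(1+|x||y|)^{d/2-3/2},\qquad K(V,x,y)=\int_{\mathbb R^d}|V(z)|\,K(z-x,y)\,dz\in[0,\infty].$$ Then $\partial_t=\Delta+V$ has a fundamental solution with sharp global Gaussian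 bounds if and only if $K(V)$ is bounded, that is, $\sup_{x,y\in\mathbb R^d}K(V,x,y)<\infty$. Moreover, any fundamental solution $G$ of $\partial_t=\Delta+V$ has sharp global Gaussian bounds if and only if $K(V)$ is bounded. -/

import Mathlib

open MeasureTheory Set
open scoped ENNReal NNReal

noncomputable section

namespace SchrodingerBounds

/-- The Gaussian kernel `g(t, x, y) = (4πt)^{-d/2} exp(-|y - x|² / (4t))`, meant for `t > 0`. -/
def gaussKernel {d : ℕ} (t : ℝ) (x y : EuclideanSpace ℝ (Fin d)) : ℝ :=
  (4 * Real.pi * t) ^ (-((d : ℝ) / 2)) * Real.exp (-(‖y - x‖ ^ 2 / (4 * t)))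

/-- `G` is a fundamental solution of `∂ₜ = Δ + V`: a Borel function on `(0,∞) × ℝᵈ × ℝᵈ` for
which the Duhamel formula
`G(t,x,y) = g(t,x,y) + ∫₀ᵗ ∫ G(s,x,z) V(z) g(t-s,z,y) dz ds`
holds for all `t > 0` and all `x, y`, the double integral being absolutely convergent.
The values of `G` at times `t ≤ 0` play no role. -/
structure IsFundamentalSolution {d : ℕ} (V : EuclideanSpace ℝ (Fin d) → ℝ)
    (G : ℝ → EuclideanSpace ℝ (Fin d) → EuclideanSpace ℝ (Fin d) → ℝ) : Prop where
  measurable : Measurable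
    (fun p : Ioi (0 : ℝ) × EuclideanSpace ℝ (Fin d) × EuclideanSpace ℝ (Fin d) =>
      G p.1 p.2.1 p.2.2)
  integrable : ∀ t : ℝ, 0 < t → ∀ x y : EuclideanSpace ℝ (Fin d),
    IntegrableOn
      (fun p : ℝ × EuclideanSpace ℝ (Fin d) => G p.1 x p.2 * V p.2 * gaussKernel (t - p.1) p.2 y)
      (Ioo 0 t ×ˢ univ)
  duhamel : ∀ t : ℝ, 0 < t → ∀ x y : EuclideanSpace ℝ (Fin d),
    G t x y = gaussKernel t x y
      + ∫ s in Ioo 0 t, ∫ z : EuclideanSpace ℝ (Fin d), G s x z * V z * gaussKernel (t - s) z y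

/-- Sharp global Gaussian bounds: `c₁ ≤ G(t,x,y) / g(t,x,y) ≤ c₂` for all `t > 0` and `x, y`,
with constants `0 < c₁ ≤ 1 ≤ c₂`. -/
def SharpGaussianBounds {d : ℕ}
    (G : ℝ → EuclideanSpace ℝ (Fin d) → EuclideanSpace ℝ (Fin d) → ℝ) : Prop :=
  ∃ c₁ c₂ : ℝ, 0 < c₁ ∧ c₁ ≤ 1 ∧ 1 ≤ c₂ ∧
    ∀ t : ℝ, 0 < t → ∀ x y : EuclideanSpace ℝ (Fin d),
      c₁ ≤ G t x y / gaussKernel t x y ∧ G t x y / gaussKernel t x y ≤ c₂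

/-- The kernel
`K(x, y) = exp(-(|x||y| - x·y)/2) |x|^{-(d-2)} (1 + |x||y|)^{d/2 - 3/2}`, meant for `d ≥ 3`.
(Its value at the single point `x = 0` does not matter for the integrals below.) -/
def kernelK {d : ℕ} (x y : EuclideanSpace ℝ (Fin d)) : ℝ :=
  Real.exp (-((‖x‖ * ‖y‖ - inner ℝ x y) / 2)) / ‖x‖ ^ ((d : ℝ) - 2)
    * (1 + ‖x‖ * ‖y‖) ^ ((d : ℝ) / 2 - 3 / 2)

/-- `K(V, x, y) = ∫ |V(z)| K(z - x, y) dz`, with values in `[0, ∞]`. -/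
def potentialK {d : ℕ} (V : EuclideanSpace ℝ (Fin d) → ℝ) (x y : EuclideanSpace ℝ (Fin d)) :
    ℝ≥0∞ :=
  ∫⁻ z : EuclideanSpace ℝ (Fin d), ENNReal.ofReal (|V z| * kernelK (z - x) y)

/-- `K(V)` is bounded: `sup_{x,y} K(V, x, y) < ∞`. -/
def BoundedK {d : ℕ} (V : EuclideanSpace ℝ (Fin d) → ℝ) : Prop :=
  (⨆ x : EuclideanSpace ℝ (Fin d), ⨆ y : EuclideanSpace ℝ (Fin d), potentialK V x y) < ∞

end SchrodingerBounds

end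

noncomputable section

namespace SchrodingerBounds

variable {d : ℕ}

/-- The Euclidean space `ℝᵈ`. -/
local notation "𝔼" => EuclideanSpace ℝ (Fin d)

/-! ### Gaussian kernels and space-time convolution -/

section

/-! Put W = -V ≥ 0 and write A W B for space-time convolution with weight W. Everything passes
through the bridge potential S = (g W g)/g, the expected integral of W along a Brownian bridge. Two
facts give the theorem: sharp bounds hold exactly when S is bounded, and S is bounded exactly when
K(V) is.

Bounds imply S bounded: if G ≥ c₁ g, Duhamel's formula g = G + G W g gives c₁ g W g ≤ G W g ≤ g,
hence S ≤ 1/c₁ (`IsFundamentalSolution.bridge_le`).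

S bounded implies bounds: for W ≤ M a solution Γ is e^{-Mt} times a perturbation series with the
nonnegative weight M - W, so 0 ≤ Γ ≤ g. The lower bound Γ ≥ g e^{-S} (`expBridge_le_schr`) is
Jensen's inequality without path integrals. The kernel g e^{-S} is submultiplicative in time, Γ is
supermultiplicative, and over a short time τ they compare up to the factor 1 - (Mτ)², so a fine
subdivision of [0,t] leaves no loss. For unbounded W the truncations min(W,n) give kernels
decreasing to a solution, with the same lower constant e^{-C} when S ≤ C. This limit solves
Duhamel's formula on both sides, hence every fundamental solution, signed ones included, equals it
(`eq_of_add_conv_eq`).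

S versus K: with ξ = (y-x)/t, the first half of the bridge is dominated by Gaussians moving from x
with velocity ξ, and time reversal handles the second half (`bridge_le_drift`). Conversely, letting
t → ∞ along y = x + tξ turns the bridge into this moving Gaussian, and Fatou's lemma bounds its
potential (`drift_le_of_bridge_le`). The kernel of that potential is ∫₀^∞ g(s, sξ, w) ds. Completing
the square takes out the exponential factor of K(w,ξ) and leaves a one-dimensional integral
comparable with |w|^{2-d} (1+|w||ξ|)^{d/2-3/2} (`lintegral_radial_le`, `le_lintegral_radial`). -/

theorem gaussKernel_pos {t : ℝ} (ht : 0 < t) (x y : 𝔼) : 0 < gaussKernel t x y := by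
  unfold gaussKernel
  have := Real.pi_pos
  positivity

theorem gaussKernel_comm (t : ℝ) (x y : 𝔼) : gaussKernel t x y = gaussKernel t y x := by
  unfold gaussKernel
  rw [norm_sub_rev]

theorem measurable_gaussKernel :
    Measurable (fun p : ℝ × 𝔼 × 𝔼 => gaussKernel p.1 p.2.1 p.2.2) := by
  unfold gaussKernel
  fun_prop

theorem norm_sq_bridge (a b : 𝔼) {s t : ℝ} (hs : 0 < s) (ht : 0 < t) :
    ‖a‖ ^ 2 / (4 * s) + ‖b - a‖ ^ 2 / (4 * t) =
      ‖b‖ ^ 2 / (4 * (s + t)) + ‖a - (s / (s + t)) • b‖ ^ 2 / (4 * (s * t / (s + t))) := by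
  have hst : s + t ≠ 0 := by positivity
  rw [norm_sub_sq_real, norm_sub_sq_real, inner_smul_right, norm_smul, real_inner_comm,
    mul_pow, Real.norm_eq_abs, sq_abs]
  field_simp
  ring

/-- The product of two Gaussian kernels is a Gaussian kernel times the Brownian bridge density. -/
theorem gaussKernel_mul_gaussKernel {s t : ℝ} (hs : 0 < s) (ht : 0 < t) (x y z : 𝔼) :
    gaussKernel s x z * gaussKernel t z y =
      gaussKernel (s + t) x y * gaussKernel (s * t / (s + t)) (x + (s / (s + t)) • (y - x)) z := by
  have hpi := Real.pi_pos
  have h := norm_sq_bridge (z - x) (y - x) hs ht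
  rw [show y - x - (z - x) = y - z by abel,
    show z - x - (s / (s + t)) • (y - x) = z - (x + (s / (s + t)) • (y - x)) by abel] at h
  unfold gaussKernel
  rw [mul_mul_mul_comm ((4 * Real.pi * s) ^ _), mul_mul_mul_comm ((4 * Real.pi * (s + t)) ^ _),
    ← Real.exp_add, ← Real.exp_add, ← neg_add, ← neg_add, h,
    ← Real.mul_rpow (by positivity) (by positivity),
    ← Real.mul_rpow (by positivity) (by positivity)]
  congr 2
  field_simp

theorem lintegral_gaussKernel {t : ℝ} (ht : 0 < t) (x : 𝔼) :
    ∫⁻ z, ENNReal.ofReal (gaussKernel t x z) = 1 := by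
  have hpi := Real.pi_pos
  have hb : 0 < 1 / (4 * t) := by positivity
  have h1 := GaussianFourier.integral_rexp_neg_mul_sq_norm (V := 𝔼) hb
  have h2 : ∀ z : 𝔼, gaussKernel t x z =
      (4 * Real.pi * t) ^ (-((d : ℝ) / 2)) * Real.exp (-(1 / (4 * t)) * ‖z - x‖ ^ 2) := by
    intro z
    unfold gaussKernel
    congr 2
    ring
  simp_rw [h2]
  have h3 : ∫ z : 𝔼, (4 * Real.pi * t) ^ (-((d : ℝ) / 2)) *
      Real.exp (-(1 / (4 * t)) * ‖z - x‖ ^ 2) = 1 := by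
    rw [integral_const_mul,
      integral_sub_right_eq_self (fun z : 𝔼 => Real.exp (-(1 / (4 * t)) * ‖z‖ ^ 2)) x, h1,
      show Real.pi / (1 / (4 * t)) = 4 * Real.pi * t by field_simp]
    simp only [finrank_euclideanSpace, Fintype.card_fin]
    rw [← Real.rpow_add (by positivity)]
    simp
  rw [← ofReal_integral_eq_lintegral_ofReal, h3, ENNReal.ofReal_one]
  · exact Integrable.of_integral_ne_zero (by rw [h3]; exact one_ne_zero)
  · exact ae_of_all _ fun z => by positivity

/-- The Gaussian kernel with values in `[0, ∞]`, extended by `0` to times `t ≤ 0`. -/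
def heat (t : ℝ) (x y : 𝔼) : ℝ≥0∞ := if 0 < t then ENNReal.ofReal (gaussKernel t x y) else 0

theorem heat_of_pos {t : ℝ} (ht : 0 < t) (x y : 𝔼) :
    heat t x y = ENNReal.ofReal (gaussKernel t x y) := if_pos ht

theorem heat_of_nonpos {t : ℝ} (ht : t ≤ 0) (x y : 𝔼) : heat t x y = 0 := if_neg ht.not_gt

theorem heat_ne_top (t : ℝ) (x y : 𝔼) : heat t x y ≠ ∞ := by
  unfold heat; split_ifs <;> simp

theorem heat_ne_zero {t : ℝ} (ht : 0 < t) (x y : 𝔼) : heat t x y ≠ 0 := by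
  rw [heat_of_pos ht]
  simpa using gaussKernel_pos ht x y

theorem heat_comm (t : ℝ) (x y : 𝔼) : heat t x y = heat t y x := by
  unfold heat; rw [gaussKernel_comm]

/-- Joint measurability of a kernel. -/
def MeasurableKernel (A : ℝ → 𝔼 → 𝔼 → ℝ≥0∞) : Prop :=
  Measurable (fun p : ℝ × 𝔼 × 𝔼 => A p.1 p.2.1 p.2.2)

theorem MeasurableKernel.comp {A : ℝ → 𝔼 → 𝔼 → ℝ≥0∞} (hA : MeasurableKernel A)
    {α : Type*} [MeasurableSpace α] {f : α → ℝ} {g h : α → 𝔼} (hf : Measurable f)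
    (hg : Measurable g) (hh : Measurable h) : Measurable (fun a => A (f a) (g a) (h a)) :=
  Measurable.comp (g := fun p : ℝ × 𝔼 × 𝔼 => A p.1 p.2.1 p.2.2) hA (hf.prodMk (hg.prodMk hh))

theorem measurableKernel_heat : MeasurableKernel (d := d) heat :=
  Measurable.ite (measurableSet_lt measurable_const measurable_fst)
    measurable_gaussKernel.ennreal_ofReal measurable_const

/-- Chapman–Kolmogorov: after factoring out g(s+t,x,y), the bridge density has total mass one. -/
theorem lintegral_heat_mul_heat {s t : ℝ} (hs : 0 < s) (ht : 0 < t) (x y : 𝔼) :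
    ∫⁻ z, heat s x z * heat t z y = heat (s + t) x y := by
  simp_rw [heat_of_pos hs, heat_of_pos ht, heat_of_pos (add_pos hs ht)]
  simp_rw [← ENNReal.ofReal_mul (gaussKernel_pos hs _ _).le, gaussKernel_mul_gaussKernel hs ht,
    ENNReal.ofReal_mul (gaussKernel_pos (add_pos hs ht) _ _).le]
  rw [lintegral_const_mul' _ _ ENNReal.ofReal_ne_top, lintegral_gaussKernel (by positivity),
    mul_one]

/-- Space-time convolution of two kernels with the weight `q` in between. -/
def conv (q : 𝔼 → ℝ≥0∞) (A B : ℝ → 𝔼 → 𝔼 → ℝ≥0∞) (t : ℝ) (x y : 𝔼) : ℝ≥0∞ :=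
  ∫⁻ p : ℝ × 𝔼, A p.1 x p.2 * q p.2 * B (t - p.1) p.2 y

variable {q r : EuclideanSpace ℝ (Fin d) → ℝ≥0∞}
  {A B C : ℝ → EuclideanSpace ℝ (Fin d) → EuclideanSpace ℝ (Fin d) → ℝ≥0∞}

theorem measurable_conv_integrand (hq : Measurable q) (hA : MeasurableKernel A)
    (hB : MeasurableKernel B) (t : ℝ) (x y : 𝔼) :
    Measurable (fun p : ℝ × 𝔼 => A p.1 x p.2 * q p.2 * B (t - p.1) p.2 y) := by
  have h1 : Measurable (fun p : ℝ × 𝔼 => A p.1 x p.2) :=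
    hA.comp measurable_fst measurable_const measurable_snd
  have h2 : Measurable (fun p : ℝ × 𝔼 => B (t - p.1) p.2 y) :=
    hB.comp (measurable_const.sub measurable_fst) measurable_snd measurable_const
  exact (h1.mul (hq.comp measurable_snd)).mul h2

theorem measurableKernel_conv (hq : Measurable q) (hA : MeasurableKernel A)
    (hB : MeasurableKernel B) : MeasurableKernel (conv q A B) := by
  refine Measurable.lintegral_prod_right'
    (f := fun u : (ℝ × 𝔼 × 𝔼) × (ℝ × 𝔼) =>
      A u.2.1 u.1.2.1 u.2.2 * q u.2.2 * B (u.1.1 - u.2.1) u.2.2 u.1.2.2) ?_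
  have h1 : Measurable (fun u : (ℝ × 𝔼 × 𝔼) × (ℝ × 𝔼) => A u.2.1 u.1.2.1 u.2.2) :=
    hA.comp (by fun_prop) (by fun_prop) (by fun_prop)
  have h2 : Measurable (fun u : (ℝ × 𝔼 × 𝔼) × (ℝ × 𝔼) => B (u.1.1 - u.2.1) u.2.2 u.1.2.2) :=
    hB.comp (by fun_prop) (by fun_prop) (by fun_prop)
  exact (h1.mul (hq.comp (by fun_prop))).mul h2

/-- Since the time integral runs over all of ℝ, associativity is Tonelli plus a translation of time
and needs no causality. -/
theorem conv_assoc (hq : Measurable q) (hr : Measurable r) (hA : MeasurableKernel A)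
    (hB : MeasurableKernel B) (hC : MeasurableKernel C) (t : ℝ) (x y : 𝔼) :
    conv r (conv q A B) C t x y = conv q A (conv r B C) t x y := by
  have hA' : Measurable (fun u : (ℝ × 𝔼) × (ℝ × 𝔼) => A u.2.1 x u.2.2) :=
    hA.comp (by fun_prop) (by fun_prop) (by fun_prop)
  have hB' : Measurable (fun u : (ℝ × 𝔼) × (ℝ × 𝔼) => B (u.1.1 - u.2.1) u.2.2 u.1.2) :=
    hB.comp (by fun_prop) (by fun_prop) (by fun_prop)
  have hC' : Measurable (fun u : (ℝ × 𝔼) × (ℝ × 𝔼) => C (t - u.1.1) u.1.2 y) :=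
    hC.comp (by fun_prop) (by fun_prop) (by fun_prop)
  have hq' : Measurable (fun u : (ℝ × 𝔼) × (ℝ × 𝔼) => q u.2.2) := hq.comp (by fun_prop)
  have hr' : Measurable (fun u : (ℝ × 𝔼) × (ℝ × 𝔼) => r u.1.2) := hr.comp (by fun_prop)
  calc conv r (conv q A B) C t x y
      = ∫⁻ p : ℝ × 𝔼, ∫⁻ u : ℝ × 𝔼, A u.1 x u.2 * q u.2 * B (p.1 - u.1) u.2 p.2 *
          (r p.2 * C (t - p.1) p.2 y) := by
        unfold conv
        refine lintegral_congr fun p => ?_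
        rw [lintegral_mul_const _ (measurable_conv_integrand hq hA hB _ _ _), mul_assoc]
    _ = ∫⁻ u : ℝ × 𝔼, ∫⁻ p : ℝ × 𝔼, A u.1 x u.2 * q u.2 * B (p.1 - u.1) u.2 p.2 *
          (r p.2 * C (t - p.1) p.2 y) :=
        lintegral_lintegral_swap
          (((hA'.mul hq').mul hB').mul (hr'.mul hC')).aemeasurable
    _ = conv q A (conv r B C) t x y := by
        unfold conv
        refine lintegral_congr fun u => ?_
        have : (volume : Measure (ℝ × 𝔼)).IsAddRightInvariant :=
          inferInstanceAs ((volume : Measure ℝ).prod (volume : Measure 𝔼)).IsAddRightInvariant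
        rw [← lintegral_const_mul _ (measurable_conv_integrand hr hB hC _ _ _),
          ← lintegral_add_right_eq_self _ ((u.1, 0) : ℝ × 𝔼)]
        refine lintegral_congr fun p => ?_
        simp only [Prod.fst_add, Prod.snd_add, add_zero, add_sub_cancel_right]
        rw [show t - (p.1 + u.1) = t - u.1 - p.1 by ring]
        ring

/-- The substitution s ↦ t - s. For symmetric kernels it exchanges the left and right forms of
Duhamel's formula. -/
theorem conv_reflect (hq : Measurable q) (hA : MeasurableKernel A) (hB : MeasurableKernel B)
    (t : ℝ) (x y : 𝔼) :
    conv q A B t x y = conv q (fun s a b => B s b a) (fun s a b => A s b a) t y x := by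
  unfold conv
  have h : MeasurePreserving (fun p : ℝ × 𝔼 => (t - p.1, p.2)) :=
    (Measure.measurePreserving_sub_left volume t).prod (MeasurePreserving.id volume)
  rw [← h.lintegral_comp (measurable_conv_integrand hq hA hB t x y)]
  refine lintegral_congr fun p => ?_
  simp only [sub_sub_cancel]
  ring

theorem conv_mono {q' : 𝔼 → ℝ≥0∞} {A' B' : ℝ → 𝔼 → 𝔼 → ℝ≥0∞} (hq : ∀ z, q z ≤ q' z)
    (hA : ∀ t x y, A t x y ≤ A' t x y) (hB : ∀ t x y, B t x y ≤ B' t x y) (t : ℝ) (x y : 𝔼) :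
    conv q A B t x y ≤ conv q' A' B' t x y := by
  unfold conv
  gcongr
  · exact hA _ _ _
  · exact hq _
  · exact hB _ _ _

theorem conv_congr {A' B' : ℝ → 𝔼 → 𝔼 → ℝ≥0∞}
    (hA : ∀ t x y, A t x y = A' t x y) (hB : ∀ t x y, B t x y = B' t x y) (t : ℝ) (x y : 𝔼) :
    conv q A B t x y = conv q A' B' t x y := by
  unfold conv
  simp_rw [hA, hB]

theorem conv_add_left (hq : Measurable q) (hA : MeasurableKernel A)
    (hC : MeasurableKernel C) (t : ℝ) (x y : 𝔼) :
    conv q (fun s a b => A s a b + B s a b) C t x y = conv q A C t x y + conv q B C t x y := by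
  unfold conv
  rw [← lintegral_add_left (measurable_conv_integrand hq hA hC _ _ _)]
  simp_rw [add_mul]

theorem conv_add_right (hq : Measurable q) (hA : MeasurableKernel A)
    (hB : MeasurableKernel B) (t : ℝ) (x y : 𝔼) :
    conv q A (fun s a b => B s a b + C s a b) t x y = conv q A B t x y + conv q A C t x y := by
  unfold conv
  rw [← lintegral_add_left (measurable_conv_integrand hq hA hB _ _ _)]
  simp_rw [mul_add]

theorem conv_add_weight (hq : Measurable q) (hA : MeasurableKernel A)
    (hB : MeasurableKernel B) (t : ℝ) (x y : 𝔼) :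
    conv (fun z => q z + r z) A B t x y = conv q A B t x y + conv r A B t x y := by
  unfold conv
  rw [← lintegral_add_left (measurable_conv_integrand hq hA hB _ _ _)]
  simp_rw [mul_add, add_mul]

/-- A kernel that vanishes at nonpositive times. -/
def Causal (A : ℝ → 𝔼 → 𝔼 → ℝ≥0∞) : Prop := ∀ t ≤ 0, ∀ x y, A t x y = 0

theorem causal_heat : Causal (d := d) heat := fun _ ht _ _ => heat_of_nonpos ht _ _

theorem Causal.conv (hA : Causal A) (hB : Causal B) : Causal (conv q A B) := by
  intro t ht x y
  unfold SchrodingerBounds.conv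
  refine (lintegral_congr fun p => ?_).trans lintegral_zero
  rcases le_or_gt p.1 0 with h | h
  · simp [hA _ h]
  · simp [hB (t - p.1) (by linarith)]

theorem conv_eq_setLIntegral (hA : Causal A) (hB : Causal B) (t : ℝ) (x y : 𝔼) :
    conv q A B t x y =
      ∫⁻ p : ℝ × 𝔼 in Ioo 0 t ×ˢ univ, A p.1 x p.2 * q p.2 * B (t - p.1) p.2 y := by
  unfold conv
  rw [← lintegral_indicator (measurableSet_Ioo.prod MeasurableSet.univ)]
  refine lintegral_congr fun p => ?_
  rcases le_or_gt p.1 0 with h | h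
  · rw [indicator_of_notMem (by simp [h.not_gt])]
    simp [hA _ h]
  rcases le_or_gt t p.1 with h' | h'
  · rw [indicator_of_notMem (by simp [h'.not_gt])]
    simp [hB (t - p.1) (by linarith)]
  · rw [indicator_of_mem]
    simp [h, h']

theorem conv_eq_lintegral_lintegral (hq : Measurable q) (hA : MeasurableKernel A)
    (hB : MeasurableKernel B) (t : ℝ) (x y : 𝔼) :
    conv q A B t x y = ∫⁻ s : ℝ, ∫⁻ z : 𝔼, A s x z * q z * B (t - s) z y := by
  unfold conv
  exact lintegral_prod _ (measurable_conv_integrand hq hA hB t x y).aemeasurable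

end

/-! ### Uniqueness, Picard iterates and supermultiplicativity of the perturbation series -/

section

variable {q W : EuclideanSpace ℝ (Fin d) → ℝ≥0∞}
  {A B : ℝ → EuclideanSpace ℝ (Fin d) → EuclideanSpace ℝ (Fin d) → ℝ≥0∞}

/-- A kernel `Γ` with `Γ + g W Γ = g` inverts the perturbation, so that `A + A W g` determines
`A`. -/
theorem eq_of_add_conv_eq {Γ : ℝ → 𝔼 → 𝔼 → ℝ≥0∞} (hq : Measurable q) (hA : MeasurableKernel A)
    (hB : MeasurableKernel B) (hΓm : MeasurableKernel Γ)
    (hΓ : ∀ t x y, Γ t x y + conv q heat Γ t x y = heat t x y)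
    (h : ∀ t x y, A t x y + conv q A heat t x y = B t x y + conv q B heat t x y)
    (hfin : ∀ t x y, conv q A heat t x y ≠ ∞) (t : ℝ) (x y : 𝔼) : A t x y = B t x y := by
  -- By associativity (D + D q g) q Γ = D q (Γ + g q Γ) = D q g. Thus D + D q g determines D q g,
  -- and D itself once this term is finite.
  have key : ∀ D : ℝ → 𝔼 → 𝔼 → ℝ≥0∞, MeasurableKernel D →
      conv q (fun s a b => D s a b + conv q D heat s a b) Γ t x y = conv q D heat t x y := by
    intro D hD
    rw [conv_add_left hq hD hΓm, conv_assoc hq hq hD measurableKernel_heat hΓm,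
      ← conv_add_right hq hD hΓm]
    exact conv_congr (fun _ _ _ => rfl) hΓ t x y
  have h1 : conv q A heat t x y = conv q B heat t x y := by
    rw [← key A hA, ← key B hB]
    exact conv_congr h (fun _ _ _ => rfl) t x y
  have h2 := h t x y
  rw [← h1] at h2
  exact (ENNReal.add_left_inj (hfin t x y)).1 h2

/-- With a factor depending on s alone, the space integral collapses by Chapman–Kolmogorov and only
the time integral of φ survives. -/
theorem conv_one_heat {φ : ℝ → ℝ≥0∞} (hφ : Measurable φ) (t : ℝ) (x y : 𝔼) :
    conv (fun _ => 1) (fun s a b => φ s * heat s a b) heat t x y =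
      (∫⁻ s in Ioo 0 t, φ s) * heat t x y := by
  have hm : MeasurableKernel (d := d) (fun s a b => φ s * heat s a b) :=
    (hφ.comp measurable_fst).mul measurableKernel_heat
  rw [conv_eq_lintegral_lintegral measurable_const hm measurableKernel_heat,
    ← lintegral_indicator measurableSet_Ioo,
    ← lintegral_mul_const _ (hφ.indicator measurableSet_Ioo)]
  refine lintegral_congr fun s => ?_
  by_cases hs : s ∈ Ioo 0 t
  · rw [indicator_of_mem hs]
    simp_rw [mul_one, mul_assoc]
    have h1 : Measurable (fun z : 𝔼 => heat s x z * heat (t - s) z y) :=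
      (measurableKernel_heat.comp measurable_const measurable_const measurable_id).mul
        (measurableKernel_heat.comp measurable_const measurable_id measurable_const)
    rw [lintegral_const_mul _ h1, lintegral_heat_mul_heat hs.1 (sub_pos.2 hs.2),
      add_sub_cancel]
  · rw [indicator_of_notMem hs, zero_mul]
    refine (lintegral_congr fun z => ?_).trans lintegral_zero
    rcases le_or_gt s 0 with h | h
    · simp [heat_of_nonpos h]
    · have : t - s ≤ 0 := by
        by_contra h'
        exact hs ⟨h, by linarith⟩
      simp [heat_of_nonpos this]

theorem setLIntegral_Ioo_deriv {f f' : ℝ → ℝ} {t : ℝ} (ht : 0 ≤ t)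
    (hf : ∀ s, HasDerivAt f (f' s) s) (hc : Continuous f') (h0 : ∀ s, 0 ≤ f' s) :
    ∫⁻ s in Ioo 0 t, ENNReal.ofReal (f' s) = ENNReal.ofReal (f t - f 0) := by
  rw [← intervalIntegral.integral_eq_sub_of_hasDerivAt (fun s _ => hf s)
    (hc.intervalIntegrable 0 t), intervalIntegral.integral_of_le ht,
    ofReal_integral_eq_lintegral_ofReal, restrict_Ioo_eq_restrict_Ioc]
  · exact (hc.intervalIntegrable 0 t).1
  · exact ae_of_all _ h0

/-- The factor `e^{ct}` with values in `[0, ∞]`. -/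
def expFactor (c t : ℝ) : ℝ≥0∞ := ENNReal.ofReal (Real.exp (c * t))

theorem measurable_expFactor (c : ℝ) : Measurable (expFactor c) := by
  unfold expFactor; fun_prop

theorem expFactor_add (c s t : ℝ) : expFactor c (s + t) = expFactor c s * expFactor c t := by
  unfold expFactor
  rw [mul_add, Real.exp_add, ENNReal.ofReal_mul (Real.exp_pos _).le]

theorem expFactor_neg_mul (c t : ℝ) : expFactor (-c) t * expFactor c t = 1 := by
  unfold expFactor
  rw [← ENNReal.ofReal_mul (Real.exp_pos _).le, ← Real.exp_add]
  simp

theorem expFactor_ne_top (c t : ℝ) : expFactor c t ≠ ∞ := ENNReal.ofReal_ne_top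

theorem lintegral_expFactor (M : ℝ≥0) {t : ℝ} (ht : 0 ≤ t) :
    1 + ∫⁻ s in Ioo 0 t, M * expFactor M s = expFactor M t := by
  have h := setLIntegral_Ioo_deriv (f := fun s => Real.exp (M * s))
    (f' := fun s => M * Real.exp (M * s)) ht
    (fun s => by simpa [mul_comm] using ((hasDerivAt_id s).const_mul (M : ℝ)).exp)
    (by fun_prop) (fun s => by positivity)
  have h1 : (1 : ℝ) ≤ Real.exp (M * t) := Real.one_le_exp (by positivity)
  simp_rw [ENNReal.ofReal_mul M.coe_nonneg, ENNReal.ofReal_coe_nnreal] at h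
  unfold expFactor
  rw [h, ← ENNReal.ofReal_one, ← ENNReal.ofReal_add zero_le_one (by simpa using h1)]
  simp

theorem lintegral_expFactor_neg (M : ℝ≥0) {t : ℝ} (ht : 0 ≤ t) :
    expFactor (-M) t + ∫⁻ s in Ioo 0 t, M * expFactor (-M) s = 1 := by
  have h := setLIntegral_Ioo_deriv (f := fun s => -Real.exp (-M * s))
    (f' := fun s => M * Real.exp (-M * s)) ht
    (fun s => by simpa [mul_comm] using ((hasDerivAt_id s).const_mul (-M : ℝ)).exp.fun_neg)
    (by fun_prop) (fun s => by positivity)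
  have h1 : Real.exp (-M * t) ≤ 1 := Real.exp_le_one_iff.2 (by
    have : 0 ≤ (M : ℝ) * t := by positivity
    linarith)
  simp_rw [ENNReal.ofReal_mul M.coe_nonneg, ENNReal.ofReal_coe_nnreal] at h
  unfold expFactor
  rw [h, ← ENNReal.ofReal_one, ← ENNReal.ofReal_add (Real.exp_pos _).le (by simpa using h1)]
  simp

theorem conv_const_mul_left (c : ℝ≥0) (A B : ℝ → 𝔼 → 𝔼 → ℝ≥0∞) (t : ℝ) (x y : 𝔼) :
    conv (fun _ => (c : ℝ≥0∞)) A B t x y =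
      conv (fun _ => 1) (fun s a b => c * A s a b) B t x y := by
  unfold conv
  refine lintegral_congr fun p => ?_
  ring

theorem conv_const_expFactor_heat (M : ℝ≥0) (c t : ℝ) (x y : 𝔼) :
    conv (fun _ => (M : ℝ≥0∞)) (fun s a b => expFactor c s * heat s a b) heat t x y =
      (∫⁻ s in Ioo 0 t, M * expFactor c s) * heat t x y := by
  rw [conv_const_mul_left, ← conv_one_heat ((measurable_expFactor c).const_mul _)]
  simp_rw [mul_assoc]

/-- Picard iterates for the equation `F = g + F q g`. -/
def picard (q : 𝔼 → ℝ≥0∞) : ℕ → ℝ → 𝔼 → 𝔼 → ℝ≥0∞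
  | 0 => heat
  | n + 1 => fun t x y => heat t x y + conv q (picard q n) heat t x y

theorem measurableKernel_picard (hq : Measurable q) (n : ℕ) : MeasurableKernel (picard q n) := by
  induction n with
  | zero => exact measurableKernel_heat
  | succ n ih => exact measurableKernel_heat.add (measurableKernel_conv hq ih measurableKernel_heat)

theorem causal_picard (q : 𝔼 → ℝ≥0∞) (n : ℕ) : Causal (picard q n) := by
  induction n with
  | zero => exact causal_heat
  | succ n ih =>
    intro t ht x y
    simp [picard, causal_heat t ht, ih.conv causal_heat t ht]

theorem picard_le_succ (q : 𝔼 → ℝ≥0∞) (n : ℕ) (t : ℝ) (x y : 𝔼) :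
    picard q n t x y ≤ picard q (n + 1) t x y := by
  induction n generalizing t x y with
  | zero => exact le_self_add
  | succ n ih =>
    simp only [picard]
    gcongr
    exact conv_mono (fun _ => le_rfl) ih (fun _ _ _ => le_rfl) t x y

theorem monotone_picard (q : 𝔼 → ℝ≥0∞) (t : ℝ) (x y : 𝔼) :
    Monotone (fun n => picard q n t x y) :=
  monotone_nat_of_le_succ fun n => picard_le_succ q n t x y

theorem picard_mono {q' : 𝔼 → ℝ≥0∞} (h : ∀ z, q z ≤ q' z) (n : ℕ) (t : ℝ) (x y : 𝔼) :
    picard q n t x y ≤ picard q' n t x y := by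
  induction n generalizing t x y with
  | zero => exact le_rfl
  | succ n ih =>
    simp only [picard]
    gcongr
    exact conv_mono h ih (fun _ _ _ => le_rfl) t x y

/-- Both recursions build the same partial sums of g + g q g + g q g q g + …; together they give the
symmetry of the iterates. -/
theorem picard_succ_eq (hq : Measurable q) (n : ℕ) (t : ℝ) (x y : 𝔼) :
    picard q (n + 1) t x y = heat t x y + conv q heat (picard q n) t x y := by
  induction n generalizing t x y with
  | zero => rfl
  | succ n ih =>
    have hp := measurableKernel_picard hq n
    have h1 : picard q (n + 2) t x y = heat t x y + conv q (picard q (n + 1)) heat t x y := rfl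
    rw [h1, conv_congr ih (fun _ _ _ => rfl), conv_add_left hq measurableKernel_heat
      measurableKernel_heat, conv_assoc hq hq measurableKernel_heat hp measurableKernel_heat,
      ← conv_add_right hq measurableKernel_heat measurableKernel_heat]
    rfl

theorem picard_comm (hq : Measurable q) (n : ℕ) (t : ℝ) (x y : 𝔼) :
    picard q n t x y = picard q n t y x := by
  induction n generalizing t x y with
  | zero => exact heat_comm t x y
  | succ n ih =>
    rw [picard_succ_eq hq, picard, heat_comm,
      conv_reflect hq measurableKernel_heat (measurableKernel_picard hq n)]
    congr 1
    exact conv_congr (fun s a b => ih s b a) (fun s a b => heat_comm s b a) t y x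

/-- The kernel e^{Mt} g solves the equation with constant weight M exactly, so it is a barrier for
every iterate. -/
theorem picard_le {M : ℝ≥0} (hM : ∀ z, q z ≤ M) (n : ℕ) (t : ℝ) (x y : 𝔼) :
    picard q n t x y ≤ expFactor M t * heat t x y := by
  rcases le_or_gt t 0 with ht | ht
  · simp [causal_picard q n t ht]
  induction n generalizing t x y with
  | zero =>
    rw [← lintegral_expFactor M ht.le, add_mul, one_mul]
    exact le_self_add
  | succ n ih =>
    rw [← lintegral_expFactor M ht.le, add_mul, one_mul, ← conv_const_expFactor_heat]
    simp only [picard]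
    gcongr
    refine conv_mono hM (fun s a b => ?_) (fun _ _ _ => le_rfl) t x y
    rcases le_or_gt s 0 with hs | hs
    · simp [causal_picard q n s hs]
    · exact ih s a b hs

/-- The minimal solution of `F = g + F q g`. -/
def picardLim (q : 𝔼 → ℝ≥0∞) (t : ℝ) (x y : 𝔼) : ℝ≥0∞ := ⨆ n, picard q n t x y

theorem measurableKernel_picardLim (hq : Measurable q) : MeasurableKernel (picardLim q) :=
  Measurable.iSup fun n => measurableKernel_picard hq n

theorem causal_picardLim (q : 𝔼 → ℝ≥0∞) : Causal (picardLim q) := by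
  intro t ht x y
  simp [picardLim, causal_picard q _ t ht]

theorem picardLim_eq (hq : Measurable q) (t : ℝ) (x y : 𝔼) :
    picardLim q t x y = heat t x y + conv q (picardLim q) heat t x y := by
  have h1 : picardLim q t x y = ⨆ n, picard q (n + 1) t x y :=
    ((monotone_picard q t x y).iSup_nat_add 1).symm
  have h2 : conv q (picardLim q) heat t x y = ⨆ n, conv q (picard q n) heat t x y := by
    unfold conv
    rw [← lintegral_iSup
      (fun n => measurable_conv_integrand hq (measurableKernel_picard hq n) measurableKernel_heat
        t x y)]
    · simp_rw [picardLim, ENNReal.iSup_mul]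
    · intro n m hnm p
      dsimp only
      gcongr
      exact monotone_picard q _ _ _ hnm
  rw [h1, h2, ENNReal.add_iSup]
  rfl

/-- Superadditivity in time of `A q g`. -/
theorem conv_heat_superadditive {A' : ℝ → 𝔼 → 𝔼 → ℝ≥0∞} {b : 𝔼 → ℝ≥0∞} (hq : Measurable q)
    (hA : MeasurableKernel A) (hA' : MeasurableKernel A') (hc : Causal A') (hb : Measurable b)
    {s t : ℝ} (hs : 0 < s) (x y : 𝔼)
    (h : ∀ r > 0, ∀ w, ∫⁻ z, b z * A' r z w ≤ A (t + r) x w) :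
    (∫⁻ z, conv q A heat t x z * heat s z y) + ∫⁻ z, b z * conv q A' heat s z y ≤
      conv q A heat (t + s) x y := by
  have hg := measurableKernel_heat (d := d)
  have e1 : ∫⁻ z, conv q A heat t x z * heat s z y =
      ∫⁻ p : ℝ × 𝔼, A p.1 x p.2 * q p.2 * ∫⁻ z, heat (t - p.1) p.2 z * heat s z y := by
    have m1 : Measurable (fun u : 𝔼 × (ℝ × 𝔼) => A u.2.1 x u.2.2) :=
      hA.comp (by fun_prop) (by fun_prop) (by fun_prop)
    have m2 : Measurable (fun u : 𝔼 × (ℝ × 𝔼) => q u.2.2) := hq.comp (by fun_prop)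
    have m3 : Measurable (fun u : 𝔼 × (ℝ × 𝔼) => heat (t - u.2.1) u.2.2 u.1) :=
      hg.comp (by fun_prop) (by fun_prop) (by fun_prop)
    have m4 : Measurable (fun u : 𝔼 × (ℝ × 𝔼) => heat s u.1 y) :=
      hg.comp (by fun_prop) (by fun_prop) (by fun_prop)
    calc _ = ∫⁻ z, ∫⁻ p : ℝ × 𝔼,
          A p.1 x p.2 * q p.2 * (heat (t - p.1) p.2 z * heat s z y) := by
          refine lintegral_congr fun z => ?_
          unfold conv
          rw [← lintegral_mul_const _ (measurable_conv_integrand hq hA hg t x z)]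
          simp_rw [mul_assoc]
      _ = ∫⁻ p : ℝ × 𝔼, ∫⁻ z,
          A p.1 x p.2 * q p.2 * (heat (t - p.1) p.2 z * heat s z y) :=
          lintegral_lintegral_swap ((m1.mul m2).mul (m3.mul m4)).aemeasurable
      _ = _ := by
          refine lintegral_congr fun p => ?_
          refine lintegral_const_mul _ ((hg.comp ?_ ?_ ?_).mul (hg.comp ?_ ?_ ?_)) <;> fun_prop
  have e2 : ∫⁻ z, b z * conv q A' heat s z y =
      ∫⁻ p : ℝ × 𝔼, (∫⁻ z, b z * A' (p.1 - t) z p.2) * (q p.2 * heat (t + s - p.1) p.2 y) := by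
    have m1 : Measurable (fun u : 𝔼 × (ℝ × 𝔼) => A' u.2.1 u.1 u.2.2) :=
      hA'.comp (by fun_prop) (by fun_prop) (by fun_prop)
    have m2 : Measurable (fun u : 𝔼 × (ℝ × 𝔼) => q u.2.2) := hq.comp (by fun_prop)
    have m3 : Measurable (fun u : 𝔼 × (ℝ × 𝔼) => heat (s - u.2.1) u.2.2 y) :=
      hg.comp (by fun_prop) (by fun_prop) (by fun_prop)
    have m4 : Measurable (fun u : 𝔼 × (ℝ × 𝔼) => b u.1) := hb.comp (by fun_prop)
    calc _ = ∫⁻ z, ∫⁻ p : ℝ × 𝔼,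
          b z * A' p.1 z p.2 * (q p.2 * heat (s - p.1) p.2 y) := by
          refine lintegral_congr fun z => ?_
          unfold conv
          rw [← lintegral_const_mul _ (measurable_conv_integrand hq hA' hg s z y)]
          simp_rw [mul_assoc]
      _ = ∫⁻ p : ℝ × 𝔼, ∫⁻ z,
          b z * A' p.1 z p.2 * (q p.2 * heat (s - p.1) p.2 y) :=
          lintegral_lintegral_swap ((m4.mul m1).mul (m2.mul m3)).aemeasurable
      _ = ∫⁻ p : ℝ × 𝔼, (∫⁻ z, b z * A' p.1 z p.2) * (q p.2 * heat (s - p.1) p.2 y) := by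
          refine lintegral_congr fun p => ?_
          refine lintegral_mul_const _ (hb.mul (hA'.comp ?_ ?_ ?_)) <;> fun_prop
      _ = _ := by
          have : (volume : Measure (ℝ × 𝔼)).IsAddRightInvariant :=
            inferInstanceAs ((volume : Measure ℝ).prod (volume : Measure 𝔼)).IsAddRightInvariant
          rw [← lintegral_add_right_eq_self _ ((-t, 0) : ℝ × 𝔼)]
          refine lintegral_congr fun p => ?_
          simp only [Prod.fst_add, Prod.snd_add, add_zero, ← sub_eq_add_neg]
          rw [show s - (p.1 - t) = t + s - p.1 by ring]
  rw [e1, e2, ← lintegral_add_left]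
  · unfold conv
    refine lintegral_mono fun p => ?_
    -- For each intermediate time only one term survives: before t the first, where the two heat
    -- kernels merge; after t the second, controlled by `h`. At time t both vanish.
    rcases lt_or_ge p.1 t with hp | hp
    · simp_rw [hc (p.1 - t) (by linarith)]
      rw [lintegral_heat_mul_heat (by linarith) hs, show t - p.1 + s = t + s - p.1 by ring]
      simp
    · simp_rw [heat_of_nonpos (show t - p.1 ≤ 0 by linarith)]
      simp only [zero_mul, lintegral_zero, mul_zero, zero_add]
      rcases eq_or_lt_of_le hp with hp' | hp'
      · simp_rw [hc (p.1 - t) (by linarith)]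
        simp
      · have := h (p.1 - t) (by linarith) p.2
        rw [add_sub_cancel] at this
        rw [mul_assoc]
        gcongr
  · refine Measurable.mul ((hA.comp ?_ ?_ ?_).mul (hq.comp ?_)) ?_
    · fun_prop
    · fun_prop
    · fun_prop
    · fun_prop
    · refine Measurable.lintegral_prod_right'
        (f := fun u : (ℝ × 𝔼) × 𝔼 => heat (t - u.1.1) u.1.2 u.2 * heat s u.2 y)
        ((hg.comp ?_ ?_ ?_).mul (hg.comp ?_ ?_ ?_)) <;> fun_prop

/-- Induction on the iterates of the second factor: in the equation at time t + s, the weight acting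
before t and the weight acting after t contribute separately. Only an inequality is needed later. -/
theorem lintegral_picardLim_mul_le (hq : Measurable q) {s t : ℝ} (ht : 0 < t) (hs : 0 < s)
    (x y : 𝔼) :
    ∫⁻ z, picardLim q t x z * picardLim q s z y ≤ picardLim q (t + s) x y := by
  have hL := measurableKernel_picardLim hq
  have hb : Measurable (fun z => picardLim q t x z) :=
    hL.comp measurable_const measurable_const measurable_id
  have hg := measurableKernel_heat (d := d)
  have base : ∀ s > 0, ∀ y, ∫⁻ z, picardLim q t x z * heat s z y =
      heat (t + s) x y + ∫⁻ z, conv q (picardLim q) heat t x z * heat s z y := by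
    intro s hs y
    rw [← lintegral_heat_mul_heat ht hs, ← lintegral_add_left]
    · refine lintegral_congr fun z => ?_
      rw [picardLim_eq hq t x z, add_mul]
    · exact (hg.comp measurable_const measurable_const measurable_id).mul
        (hg.comp measurable_const measurable_id measurable_const)
  have step : ∀ n, ∀ s > 0, ∀ y,
      ∫⁻ z, picardLim q t x z * picard q n s z y ≤ picardLim q (t + s) x y := by
    intro n
    induction n with
    | zero =>
      intro s hs y
      simp only [picard]
      rw [base s hs, picardLim_eq hq (t + s)]
      gcongr
      -- For the zeroth iterate nothing acts after time t, so the second term of the superadditivity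
      -- is taken to be zero.
      refine le_trans le_self_add
        (conv_heat_superadditive (A' := fun _ _ _ => 0) (b := 0) hq hL measurable_const ?_
        measurable_const hs x y ?_)
      · intro _ _ _ _; rfl
      · simp
    | succ n ih =>
      intro s hs y
      have hp := measurableKernel_picard hq n
      have hm : Measurable (fun z => picardLim q t x z * heat s z y) :=
        hb.mul (hg.comp measurable_const measurable_id measurable_const)
      simp only [picard, mul_add]
      rw [lintegral_add_left hm, base s hs,
        picardLim_eq hq (t + s), add_assoc]
      gcongr
      exact conv_heat_superadditive hq hL hp (causal_picard q n) hb hs x y ih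
  have h1 : ∫⁻ z, picardLim q t x z * picardLim q s z y =
      ⨆ n, ∫⁻ z, picardLim q t x z * picard q n s z y := by
    rw [← lintegral_iSup]
    · refine lintegral_congr fun z => ?_
      rw [← ENNReal.mul_iSup]
      rfl
    · intro n
      exact hb.mul ((measurableKernel_picard hq n).comp measurable_const measurable_id
        measurable_const)
    · intro n m hnm z
      dsimp only
      gcongr
      exact monotone_picard q _ _ _ hnm
  rw [h1]
  exact iSup_le fun n => step n s hs y

end

/-! ### Bounded absorption rates: the solution and its lower bound -/

section

variable {q W : EuclideanSpace ℝ (Fin d) → ℝ≥0∞}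
  {A B : ℝ → EuclideanSpace ℝ (Fin d) → EuclideanSpace ℝ (Fin d) → ℝ≥0∞}

theorem lintegral_const_Ioo (M : ℝ≥0) (t : ℝ) :
    ∫⁻ _ in Ioo 0 t, (M : ℝ≥0∞) = M * ENNReal.ofReal t := by
  simp

theorem conv_heat_heat_le {M : ℝ≥0} (hM : ∀ z, W z ≤ M) (t : ℝ) (x y : 𝔼) :
    conv W heat heat t x y ≤ ENNReal.ofReal (M * t) * heat t x y := by
  have h := conv_const_expFactor_heat (d := d) M 0 t x y
  simp only [expFactor, zero_mul, Real.exp_zero, ENNReal.ofReal_one, one_mul, mul_one,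
    lintegral_const_Ioo] at h
  rw [ENNReal.ofReal_mul M.coe_nonneg, ENNReal.ofReal_coe_nnreal, ← h]
  exact conv_mono hM (fun _ _ _ => le_rfl) (fun _ _ _ => le_rfl) t x y

/-- The heat kernel with the absorption rate `W`, for `0 ≤ W ≤ M`. -/
def schr (M : ℝ≥0) (W : 𝔼 → ℝ≥0∞) (t : ℝ) (x y : 𝔼) : ℝ≥0∞ :=
  expFactor (-M) t * picardLim (fun z => M - W z) t x y

theorem measurableKernel_schr (M : ℝ≥0) (hW : Measurable W) : MeasurableKernel (schr M W) :=
  ((measurable_expFactor _).comp measurable_fst).mul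
    (measurableKernel_picardLim (measurable_const.sub hW))

theorem causal_schr (M : ℝ≥0) (W : 𝔼 → ℝ≥0∞) : Causal (schr M W) := by
  intro t ht x y
  simp [schr, causal_picardLim _ t ht]

theorem schr_le_heat (M : ℝ≥0) (W : 𝔼 → ℝ≥0∞) (t : ℝ) (x y : 𝔼) :
    schr M W t x y ≤ heat t x y := by
  unfold schr
  calc _ ≤ expFactor (-M) t * (expFactor M t * heat t x y) := by
        gcongr
        exact iSup_le fun n => picard_le (fun z => tsub_le_self) n t x y
    _ = heat t x y := by rw [← mul_assoc, expFactor_neg_mul, one_mul]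

theorem schr_comm (M : ℝ≥0) (hW : Measurable W) (t : ℝ) (x y : 𝔼) :
    schr M W t x y = schr M W t y x := by
  unfold schr picardLim
  congr 1
  exact iSup_congr fun n => picard_comm (measurable_const.sub hW) n t x y

theorem schr_anti (M : ℝ≥0) {W' : 𝔼 → ℝ≥0∞} (h : ∀ z, W z ≤ W' z) (t : ℝ) (x y : 𝔼) :
    schr M W' t x y ≤ schr M W t x y := by
  unfold schr picardLim
  gcongr
  exact picard_mono (fun z => tsub_le_tsub_left (h z) _) _ _ _ _

theorem lintegral_schr_mul_le (M : ℝ≥0) (hW : Measurable W) {s t : ℝ} (ht : 0 < t) (hs : 0 < s)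
    (x y : 𝔼) : ∫⁻ z, schr M W t x z * schr M W s z y ≤ schr M W (t + s) x y := by
  have hq : Measurable (fun z => (M : ℝ≥0∞) - W z) := measurable_const.sub hW
  have hL := measurableKernel_picardLim hq
  unfold schr
  simp_rw [mul_mul_mul_comm (expFactor (-M) t), ← expFactor_add]
  rw [lintegral_const_mul' _ _ (expFactor_ne_top _ _)]
  gcongr
  exact lintegral_picardLim_mul_le hq ht hs x y

/-- The weight M - W is nonnegative, so the series has no subtractions; the factor e^{-Mt} then
compensates for the added constant M. -/
theorem schr_add_conv (M : ℝ≥0) (hW : Measurable W) (hM : ∀ z, W z ≤ M) (t : ℝ) (x y : 𝔼) :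
    schr M W t x y + conv W (schr M W) heat t x y = heat t x y := by
  set q : 𝔼 → ℝ≥0∞ := fun z => M - W z with hq_def
  have hq : Measurable q := measurable_const.sub hW
  have hG := measurableKernel_schr M hW
  have hg := measurableKernel_heat (d := d)
  set gM : ℝ → 𝔼 → 𝔼 → ℝ≥0∞ := fun s a b => expFactor (-M) s * heat s a b with hgM_def
  have hgM : MeasurableKernel gM := ((measurable_expFactor _).comp measurable_fst).mul hg
  have hM' : Measurable (fun _ : 𝔼 => (M : ℝ≥0∞)) := measurable_const
  have e1 : ∀ t x y, schr M W t x y = gM t x y + conv q (schr M W) gM t x y := by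
    intro t x y
    rw [schr, picardLim_eq hq, mul_add]
    congr 1
    unfold conv
    rw [← lintegral_const_mul _
      (measurable_conv_integrand hq (measurableKernel_picardLim hq) hg _ _ _)]
    refine lintegral_congr fun p => ?_
    have : expFactor (-M) t = expFactor (-M) p.1 * expFactor (-M) (t - p.1) := by
      rw [← expFactor_add, add_sub_cancel]
    rw [this, schr, hgM_def]
    ring
  have e2 : ∀ t x y, gM t x y + conv (fun _ => (M : ℝ≥0∞)) gM heat t x y = heat t x y := by
    intro t x y
    rcases le_or_gt t 0 with ht | ht
    · have hc : Causal gM := by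
        intro s hs a b
        simp [hgM_def, heat_of_nonpos hs]
      rw [hc t ht, hc.conv causal_heat t ht, heat_of_nonpos ht, add_zero]
    · rw [conv_const_expFactor_heat, ← add_mul, lintegral_expFactor_neg M ht.le, one_mul]
  -- Let Γ be the kernel and g_M = e^{-Mt} g. Convolve `e1` on the right with M g, add `e1`, and use
  -- g_M + M g_M g = g twice. Splitting M = (M - W) + W then leaves a finite term Γ (M - W) g to
  -- cancel.
  have e3 : gM t x y + conv q (schr M W) gM t x y + conv (fun _ => (M : ℝ≥0∞)) (schr M W) heat t x y
      = heat t x y + conv q (schr M W) heat t x y := by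
    have hqG := measurableKernel_conv hq hG hgM
    have hMg := measurableKernel_conv hM' hgM hg
    rw [conv_congr (q := fun _ => (M : ℝ≥0∞)) e1 (fun a b c => rfl (a := heat a b c)),
      conv_add_left hM' hgM hg,
      conv_assoc hq hM' hG hgM hg, add_add_add_comm, e2, ← conv_add_right hq hG hgM]
    congr 1
    exact conv_congr (fun _ _ _ => rfl) e2 t x y
  have e4 : conv (fun _ => (M : ℝ≥0∞)) (schr M W) heat t x y =
      conv q (schr M W) heat t x y + conv W (schr M W) heat t x y := by
    rw [← conv_add_weight hq hG hg]
    congr 1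
    funext z
    exact (tsub_add_cancel_of_le (hM z)).symm
  have hfin : conv q (schr M W) heat t x y ≠ ∞ := by
    refine ne_top_of_le_ne_top ?_ ((conv_mono (fun _ => le_rfl) (schr_le_heat M W)
      (fun _ _ _ => le_rfl) t x y).trans (conv_heat_heat_le (fun z => tsub_le_self) t x y))
    exact ENNReal.mul_ne_top ENNReal.ofReal_ne_top (heat_ne_top _ _ _)
  rw [← e1, e4] at e3
  refine (ENNReal.add_left_inj hfin).1 ?_
  rw [← e3]
  ring

/-- The potential `S(W) = (g W g) / g` of the Brownian bridge. -/
def bridge (W : 𝔼 → ℝ≥0∞) (t : ℝ) (x y : 𝔼) : ℝ≥0∞ := conv W heat heat t x y / heat t x y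

theorem heat_mul_bridge {t : ℝ} (ht : 0 < t) (x y : 𝔼) :
    heat t x y * bridge W t x y = conv W heat heat t x y :=
  ENNReal.mul_div_cancel (heat_ne_zero ht x y) (heat_ne_top t x y)

theorem bridge_le_iff {t : ℝ} (ht : 0 < t) (x y : 𝔼) (c : ℝ≥0∞) :
    bridge W t x y ≤ c ↔ conv W heat heat t x y ≤ c * heat t x y :=
  ENNReal.div_le_iff (heat_ne_zero ht x y) (heat_ne_top t x y)

theorem bridge_le_of_le {M : ℝ≥0} (hM : ∀ z, W z ≤ M) {t : ℝ} (ht : 0 < t) (x y : 𝔼) :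
    bridge W t x y ≤ ENNReal.ofReal (M * t) :=
  (bridge_le_iff ht x y _).2 (conv_heat_heat_le hM t x y)

/-- The kernel `g e^{-S(W)}`. -/
def expBridge (W : 𝔼 → ℝ≥0∞) (t : ℝ) (x y : 𝔼) : ℝ≥0∞ :=
  heat t x y * ENNReal.ofReal (Real.exp (-(bridge W t x y).toReal))

theorem measurableKernel_bridge (hW : Measurable W) : MeasurableKernel (bridge W) :=
  (measurableKernel_conv hW measurableKernel_heat measurableKernel_heat).div measurableKernel_heat

theorem measurableKernel_expBridge (hW : Measurable W) : MeasurableKernel (expBridge W) :=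
  measurableKernel_heat.mul
    (Real.measurable_exp.comp (measurableKernel_bridge hW).ennreal_toReal.neg).ennreal_ofReal

/-- Jensen's inequality for `g e^{-S(W)}`. -/
theorem expBridge_add_le {M : ℝ≥0} (hW : Measurable W) (hM : ∀ z, W z ≤ M) {s t : ℝ}
    (ht : 0 < t) (hs : 0 < s) (x y : 𝔼) :
    expBridge W (t + s) x y ≤ ∫⁻ z, expBridge W t x z * expBridge W s z y := by
  have hg := measurableKernel_heat (d := d)
  have hp := measurableKernel_conv hW hg hg
  have hJ := measurableKernel_expBridge hW
  -- Finiteness makes `toReal` faithful here; an infinite value would be read as 0 and spoil the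
  -- exponential.
  have hne : ∀ r > 0, ∀ a b : 𝔼, bridge W r a b ≠ ∞ := fun r hr a b =>
    ne_top_of_le_ne_top ENNReal.ofReal_ne_top (bridge_le_of_le hM hr a b)
  set a : ℝ := (bridge W (t + s) x y).toReal with ha_def
  have ha : 0 ≤ a := ENNReal.toReal_nonneg
  have hts : 0 < t + s := add_pos ht hs
  have hmJ : Measurable (fun z => expBridge W t x z * expBridge W s z y) :=
    (hJ.comp measurable_const measurable_const measurable_id).mul
      (hJ.comp measurable_const measurable_id measurable_const)
  -- The tangent line of e^{-·} at a, e^{-(u+v)} ≥ e^{-a}(1 + a - (u+v)), multiplied by the heat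
  -- kernels and with the negative term moved across. Integrating, superadditivity of g W g bounds
  -- the mean of u + v by a.
  have h1 : ∀ z, heat t x z * heat s z y * ENNReal.ofReal (Real.exp (-a) * (1 + a)) ≤
      expBridge W t x z * expBridge W s z y + ENNReal.ofReal (Real.exp (-a)) *
        (conv W heat heat t x z * heat s z y + heat t x z * conv W heat heat s z y) := by
    intro z
    set u : ℝ := (bridge W t x z).toReal with hu_def
    set v : ℝ := (bridge W s z y).toReal with hv_def
    have hu : 0 ≤ u := ENNReal.toReal_nonneg
    have hv : 0 ≤ v := ENNReal.toReal_nonneg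
    have hr : Real.exp (-a) * (1 + a) ≤
        Real.exp (-u) * Real.exp (-v) + Real.exp (-a) * (u + v) := by
      have h2 := Real.add_one_le_exp (a - (u + v))
      have h3 : Real.exp (-u) * Real.exp (-v) = Real.exp (-a) * Real.exp (a - (u + v)) := by
        rw [← Real.exp_add, ← Real.exp_add]
        congr 1
        ring
      have h4 := mul_le_mul_of_nonneg_left h2 (Real.exp_pos (-a)).le
      rw [h3]
      linarith
    calc _ ≤ heat t x z * heat s z y * ENNReal.ofReal
          (Real.exp (-u) * Real.exp (-v) + Real.exp (-a) * (u + v)) := by gcongr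
      _ = _ := by
        rw [ENNReal.ofReal_add (by positivity) (by positivity),
          ENNReal.ofReal_mul (Real.exp_pos _).le, ENNReal.ofReal_mul (Real.exp_pos _).le,
          ENNReal.ofReal_add hu hv, hu_def, hv_def, ENNReal.ofReal_toReal (hne t ht x z),
          ENNReal.ofReal_toReal (hne s hs z y), ← heat_mul_bridge ht, ← heat_mul_bridge hs]
        unfold expBridge
        ring
  have h2 : heat (t + s) x y * ENNReal.ofReal (Real.exp (-a) * (1 + a)) ≤
      (∫⁻ z, expBridge W t x z * expBridge W s z y) + ENNReal.ofReal (Real.exp (-a)) *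
        conv W heat heat (t + s) x y := by
    have hmp : Measurable (fun z => conv W heat heat t x z * heat s z y) :=
      (hp.comp measurable_const measurable_const measurable_id).mul
        (hg.comp measurable_const measurable_id measurable_const)
    calc _ = ∫⁻ z, heat t x z * heat s z y * ENNReal.ofReal (Real.exp (-a) * (1 + a)) := by
          rw [lintegral_mul_const' _ _ ENNReal.ofReal_ne_top, lintegral_heat_mul_heat ht hs]
      _ ≤ _ := lintegral_mono h1
      _ = (∫⁻ z, expBridge W t x z * expBridge W s z y) + ENNReal.ofReal (Real.exp (-a)) *
          ((∫⁻ z, conv W heat heat t x z * heat s z y) +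
            ∫⁻ z, heat t x z * conv W heat heat s z y) := by
          rw [lintegral_add_left hmJ, lintegral_const_mul' _ _ ENNReal.ofReal_ne_top,
            lintegral_add_left hmp]
      _ ≤ _ := by
          gcongr
          exact conv_heat_superadditive hW hg hg causal_heat
            (hg.comp measurable_const measurable_const measurable_id) hs x y
            fun r hr w => (lintegral_heat_mul_heat ht hr x w).le
  have hfin : ENNReal.ofReal (Real.exp (-a)) * conv W heat heat (t + s) x y ≠ ∞ :=
    ENNReal.mul_ne_top ENNReal.ofReal_ne_top (ne_top_of_le_ne_top
      (ENNReal.mul_ne_top ENNReal.ofReal_ne_top (heat_ne_top _ _ _))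
      (conv_heat_heat_le hM (t + s) x y))
  refine (ENNReal.add_le_add_iff_right hfin).1 (le_trans (le_of_eq ?_) h2)
  rw [mul_add, mul_one, ENNReal.ofReal_add (Real.exp_pos _).le (by positivity),
    ENNReal.ofReal_mul (Real.exp_pos _).le, ← heat_mul_bridge hts, ha_def,
    ENNReal.ofReal_toReal (hne _ hts x y)]
  unfold expBridge
  ring

/-- With σ = S, Duhamel's formula and Γ ≤ g give Γ ≥ (1 - σ) g, while (1 - σ²) e^{-σ} ≤ 1 - σ and σ
≤ Mt ≤ 1. The loss is of second order in t, which is what lets the subdivision argument converge. -/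
theorem mul_expBridge_le_schr_of_small {M : ℝ≥0} (hW : Measurable W) (hM : ∀ z, W z ≤ M) {t : ℝ}
    (ht : 0 < t) (hMt : M * t ≤ 1) (x y : 𝔼) :
    ENNReal.ofReal (1 - (M * t) ^ 2) * expBridge W t x y ≤ schr M W t x y := by
  set σ : ℝ := (bridge W t x y).toReal with hσ_def
  have hle := bridge_le_of_le hM ht x y
  have hne : bridge W t x y ≠ ∞ := ne_top_of_le_ne_top ENNReal.ofReal_ne_top hle
  have hσ0 : 0 ≤ σ := ENNReal.toReal_nonneg
  have hMt0 : 0 ≤ (M : ℝ) * t := by positivity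
  have hσ : σ ≤ M * t := ENNReal.toReal_le_of_le_ofReal hMt0 hle
  have hσe : bridge W t x y = ENNReal.ofReal σ := (ENNReal.ofReal_toReal hne).symm
  have hr : (1 - (M * t) ^ 2) * Real.exp (-σ) + σ ≤ 1 := by
    have h1 : (1 + σ) * Real.exp (-σ) ≤ 1 := by
      rw [Real.exp_neg, ← div_eq_mul_inv, div_le_one (Real.exp_pos _), add_comm]
      exact Real.add_one_le_exp σ
    have h2 : σ ^ 2 ≤ (M * t) ^ 2 := pow_le_pow_left₀ hσ0 hσ 2
    have h3 := mul_le_mul_of_nonneg_right (sub_le_sub_left h2 1) (Real.exp_pos (-σ)).le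
    have h4 := mul_le_mul_of_nonneg_left h1 (show 0 ≤ 1 - σ by linarith)
    nlinarith
  have h1 : heat t x y ≤ schr M W t x y + heat t x y * bridge W t x y := by
    rw [heat_mul_bridge ht]
    nth_rw 1 [← schr_add_conv M hW hM t x y]
    gcongr
    exact conv_mono (fun _ => le_rfl) (schr_le_heat M W) (fun _ _ _ => le_rfl) t x y
  refine (ENNReal.add_le_add_iff_right (ENNReal.mul_ne_top (heat_ne_top t x y) hne)).1
    (le_trans ?_ h1)
  unfold expBridge
  rw [hσe, ENNReal.toReal_ofReal hσ0, mul_left_comm, ← mul_add, ← ENNReal.ofReal_mul, ← ENNReal.ofReal_add]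
  · calc _ ≤ heat t x y * 1 := by
          gcongr
          rw [← ENNReal.ofReal_one]
          exact ENNReal.ofReal_le_ofReal hr
      _ = _ := mul_one _
  · have : 0 ≤ 1 - (M * t) ^ 2 := by nlinarith
    positivity
  · exact hσ0
  · nlinarith

/-- The lower bound `g e^{-S(W)}` for bounded absorption rates. -/
theorem expBridge_le_schr {M : ℝ≥0} (hW : Measurable W) (hM : ∀ z, W z ≤ M) {t : ℝ}
    (ht : 0 < t) (x y : 𝔼) : expBridge W t x y ≤ schr M W t x y := by
  -- Gluing k + 1 pieces of length τ: submultiplicativity of g e^{-S} meets supermultiplicativity of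
  -- Γ, and each piece costs one factor 1 - (Mτ)².
  have step : ∀ τ : ℝ, 0 < τ → M * τ ≤ 1 → ∀ k : ℕ, ∀ x y : 𝔼,
      ENNReal.ofReal (1 - (M * τ) ^ 2) ^ (k + 1) * expBridge W ((k + 1) * τ) x y ≤
        schr M W ((k + 1) * τ) x y := by
    intro τ hτ hMτ k
    induction k with
    | zero =>
      intro x y
      simpa using mul_expBridge_le_schr_of_small hW hM hτ hMτ x y
    | succ k ih =>
      intro x y
      have hk : (0 : ℝ) < (k + 1) * τ := by positivity
      have e : (((k + 1 : ℕ) : ℝ) + 1) * τ = (k + 1) * τ + τ := by push_cast; ring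
      rw [e]
      refine le_trans ?_ (lintegral_schr_mul_le M hW hk hτ x y)
      calc _ ≤ ENNReal.ofReal (1 - (M * τ) ^ 2) ^ (k + 1 + 1) *
            ∫⁻ z, expBridge W ((k + 1) * τ) x z * expBridge W τ z y := by
            gcongr
            exact expBridge_add_le hW hM hk hτ x y
        _ = ∫⁻ z, (ENNReal.ofReal (1 - (M * τ) ^ 2) ^ (k + 1) * expBridge W ((k + 1) * τ) x z) *
            (ENNReal.ofReal (1 - (M * τ) ^ 2) * expBridge W τ z y) := by
            rw [← lintegral_const_mul' _ _ (ENNReal.pow_ne_top ENNReal.ofReal_ne_top)]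
            refine lintegral_congr fun z => ?_
            ring
        _ ≤ _ := by
            gcongr with z
            · exact ih x z
            · exact mul_expBridge_le_schr_of_small hW hM hτ hMτ z y
  have hlim : Filter.Tendsto (fun n : ℕ => ENNReal.ofReal (1 - (M * t) ^ 2 * (1 / ((n : ℝ) + 1))) *
      expBridge W t x y) Filter.atTop (nhds (expBridge W t x y)) := by
    have h1 : Filter.Tendsto (fun n : ℕ => 1 - (M * t) ^ 2 * (1 / ((n : ℝ) + 1))) Filter.atTop
        (nhds 1) := by
      simpa using (tendsto_one_div_add_atTop_nhds_zero_nat (𝕜 := ℝ)).const_mul ((M * t) ^ 2)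
        |>.const_sub 1
    have h2 := ENNReal.tendsto_ofReal h1
    rw [ENNReal.ofReal_one] at h2
    simpa using ENNReal.Tendsto.mul_const (b := expBridge W t x y) h2 (Or.inl one_ne_zero)
  refine le_of_tendsto hlim ?_
  obtain ⟨N, hN⟩ := exists_nat_ge (M * t)
  filter_upwards [Filter.eventually_ge_atTop N] with n hn
  have hn1 : (0 : ℝ) < (n : ℝ) + 1 := by positivity
  have hnN : (N : ℝ) ≤ n := by exact_mod_cast hn
  have hsmall : M * (t / ((n : ℝ) + 1)) ≤ 1 := by
    rw [← mul_div_assoc, div_le_one hn1]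
    linarith
  have h := step (t / ((n : ℝ) + 1)) (by positivity) hsmall n x y
  rw [mul_div_cancel₀ _ hn1.ne'] at h
  refine le_trans ?_ h
  gcongr
  have h0 : 0 ≤ (M : ℝ) * (t / ((n : ℝ) + 1)) := by positivity
  rw [← ENNReal.ofReal_pow (by nlinarith)]
  refine ENNReal.ofReal_le_ofReal ?_
  -- Bernoulli: (1 - (Mt/(n+1))²)^{n+1} ≥ 1 - (Mt)²/(n+1), which tends to 1.
  have hb := one_add_mul_le_pow (a := -(M * (t / ((n : ℝ) + 1))) ^ 2) (by nlinarith) (n + 1)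
  rw [← sub_eq_add_neg] at hb
  refine le_trans (le_of_eq ?_) hb
  push_cast
  field_simp
  ring

theorem exp_neg_mul_heat_le_schr {M C : ℝ≥0} (hW : Measurable W) (hM : ∀ z, W z ≤ M) {t : ℝ}
    (ht : 0 < t) (x y : 𝔼) (hC : bridge W t x y ≤ C) :
    ENNReal.ofReal (Real.exp (-C)) * heat t x y ≤ schr M W t x y := by
  refine le_trans ?_ (expBridge_le_schr hW hM ht x y)
  rw [expBridge, mul_comm]
  gcongr
  exact ENNReal.toReal_le_coe_of_le_coe hC

end

/-! ### Unbounded rates by truncation, and identification of fundamental solutions -/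

section

variable {q W : EuclideanSpace ℝ (Fin d) → ℝ≥0∞}
  {A B : ℝ → EuclideanSpace ℝ (Fin d) → EuclideanSpace ℝ (Fin d) → ℝ≥0∞}

theorem add_conv_heat_left {Γ : ℝ → 𝔼 → 𝔼 → ℝ≥0∞} (hW : Measurable W)
    (hΓm : MeasurableKernel Γ) (hcomm : ∀ t x y, Γ t x y = Γ t y x)
    (h : ∀ t x y, Γ t x y + conv W Γ heat t x y = heat t x y) (t : ℝ) (x y : 𝔼) :
    Γ t x y + conv W heat Γ t x y = heat t x y := by
  rw [conv_reflect hW measurableKernel_heat hΓm,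
    conv_congr (fun s a b => hcomm s b a) (fun s a b => heat_comm s b a), hcomm, h, heat_comm]

theorem conv_ne_top_of_bounded {M : ℝ≥0} (hM : ∀ z, W z ≤ M) (hA : ∀ t x y, A t x y ≤ heat t x y)
    (t : ℝ) (x y : 𝔼) : conv W A heat t x y ≠ ∞ :=
  ne_top_of_le_ne_top (ENNReal.mul_ne_top ENNReal.ofReal_ne_top (heat_ne_top t x y))
    ((conv_mono (fun _ => le_rfl) hA (fun _ _ _ => le_rfl) t x y).trans
      (conv_heat_heat_le hM t x y))

/-- By uniqueness the auxiliary bound M is immaterial. This allows truncations at different levels,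
built with different bounds, to be compared. -/
theorem schr_eq_schr {M M' : ℝ≥0} (hW : Measurable W) (hM : ∀ z, W z ≤ M) (hM' : ∀ z, W z ≤ M')
    (t : ℝ) (x y : 𝔼) : schr M W t x y = schr M' W t x y :=
  eq_of_add_conv_eq hW (measurableKernel_schr M hW) (measurableKernel_schr M' hW)
    (measurableKernel_schr M hW)
    (add_conv_heat_left hW (measurableKernel_schr M hW) (schr_comm M hW) (schr_add_conv M hW hM))
    (fun t x y => (schr_add_conv M hW hM t x y).trans (schr_add_conv M' hW hM' t x y).symm)
    (conv_ne_top_of_bounded hM (schr_le_heat M W)) t x y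

/-- The truncation `min (W, n)`. -/
def trunc (W : 𝔼 → ℝ≥0∞) (n : ℕ) (z : 𝔼) : ℝ≥0∞ := min (W z) n

theorem measurable_trunc (hW : Measurable W) (n : ℕ) : Measurable (trunc W n) :=
  hW.min measurable_const

theorem trunc_le (W : 𝔼 → ℝ≥0∞) (n : ℕ) (z : 𝔼) : trunc W n z ≤ (n : ℝ≥0) := by
  simp [trunc]

theorem trunc_mono (W : 𝔼 → ℝ≥0∞) {n m : ℕ} (h : n ≤ m) (z : 𝔼) : trunc W n z ≤ trunc W m z := by
  unfold trunc
  gcongr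

/-- The kernel for the rate `min (W, n)`. -/
def schrTrunc (W : 𝔼 → ℝ≥0∞) (n : ℕ) : ℝ → 𝔼 → 𝔼 → ℝ≥0∞ := schr (n : ℝ≥0) (trunc W n)

theorem antitone_schrTrunc (hW : Measurable W) (t : ℝ) (x y : 𝔼) :
    Antitone (fun n => schrTrunc W n t x y) := by
  refine antitone_nat_of_succ_le fun n => ?_
  unfold schrTrunc
  rw [schr_eq_schr (measurable_trunc hW n) (trunc_le W n) (M' := ((n + 1 : ℕ) : ℝ≥0))
    (fun z => (trunc_mono W n.le_succ z).trans (trunc_le W (n + 1) z))]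
  exact schr_anti _ (trunc_mono W n.le_succ) t x y

/-- A kernel solving both forms of Duhamel's formula exists if `S(W)` is bounded. -/
theorem exists_schr_of_bridge_le (hW : Measurable W) (hfin : ∀ z, W z ≠ ∞) {C : ℝ≥0}
    (hC : ∀ t > 0, ∀ x y, bridge W t x y ≤ C) :
    ∃ Γ : ℝ → 𝔼 → 𝔼 → ℝ≥0∞, MeasurableKernel Γ ∧ Causal Γ ∧ (∀ t x y, Γ t x y ≤ heat t x y) ∧
      (∀ t x y, ENNReal.ofReal (Real.exp (-C)) * heat t x y ≤ Γ t x y) ∧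
      (∀ t x y, Γ t x y + conv W Γ heat t x y = heat t x y) ∧
      (∀ t x y, Γ t x y + conv W heat Γ t x y = heat t x y) := by
  set Γ : ℝ → 𝔼 → 𝔼 → ℝ≥0∞ := fun t x y => ⨅ n, schrTrunc W n t x y with hΓ_def
  have hg := measurableKernel_heat (d := d)
  have hm : ∀ n, MeasurableKernel (schrTrunc W n) := fun n =>
    measurableKernel_schr _ (measurable_trunc hW n)
  have hΓ : MeasurableKernel Γ := Measurable.iInf hm
  have hle : ∀ n t x y, schrTrunc W n t x y ≤ heat t x y := fun n => schr_le_heat _ _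
  have hcausal : Causal Γ := fun t ht x y => by
    simp [hΓ_def, schrTrunc, causal_schr _ _ t ht]
  have hlim : ∀ t x y, Filter.Tendsto (fun n => schrTrunc W n t x y) Filter.atTop
      (nhds (Γ t x y)) := fun t x y => tendsto_atTop_iInf (antitone_schrTrunc hW t x y)
  have hconv : ∀ t x y, conv W heat heat t x y ≠ ∞ := by
    intro t x y
    rcases le_or_gt t 0 with ht | ht
    · simp [causal_heat.conv causal_heat t ht]
    · exact ne_top_of_le_ne_top (ENNReal.mul_ne_top ENNReal.coe_ne_top (heat_ne_top t x y))
        ((bridge_le_iff ht x y _).1 (hC t ht x y))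
  have hcomm : ∀ t x y, Γ t x y = Γ t y x := fun t x y =>
    iInf_congr fun n => schr_comm _ (measurable_trunc hW n) t x y
  have hduh : ∀ t x y, Γ t x y + conv W Γ heat t x y = heat t x y := by
    intro t x y
    have h1 : Filter.Tendsto (fun n => conv (trunc W n) (schrTrunc W n) heat t x y) Filter.atTop
        (nhds (conv W Γ heat t x y)) := by
      -- The dominating function is the integrand of g W g, whose integral is finite because S is
      -- bounded.
      refine tendsto_lintegral_of_dominated_convergence
        (fun p : ℝ × 𝔼 => heat p.1 x p.2 * W p.2 * heat (t - p.1) p.2 y)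
        (fun n => measurable_conv_integrand (measurable_trunc hW n) (hm n) hg t x y)
        (fun n => ae_of_all _ fun p => ?_) (hconv t x y) (ae_of_all _ fun p => ?_)
      · dsimp only
        gcongr
        · exact hle n _ _ _
        · exact min_le_left _ _
      · have h2 : Filter.Tendsto (fun n => trunc W n p.2) Filter.atTop (nhds (W p.2)) := by
          refine tendsto_const_nhds.congr' ?_
          obtain ⟨N, hN⟩ := ENNReal.exists_nat_gt (hfin p.2)
          filter_upwards [Filter.eventually_ge_atTop N] with n hn
          refine (min_eq_left (hN.le.trans ?_)).symm
          exact_mod_cast hn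
        have hne : Γ p.1 x p.2 ≠ ∞ :=
          ne_top_of_le_ne_top (heat_ne_top _ _ _) ((iInf_le _ 0).trans (hle 0 p.1 x p.2))
        exact ENNReal.Tendsto.mul_const
          (ENNReal.Tendsto.mul (hlim p.1 x p.2) (Or.inr (hfin _)) h2 (Or.inr hne))
          (Or.inr (heat_ne_top _ _ _))
    refine tendsto_nhds_unique ((hlim t x y).add h1) (tendsto_const_nhds.congr fun n => ?_)
    exact (schr_add_conv _ (measurable_trunc hW n) (trunc_le W n) t x y).symm
  refine ⟨Γ, hΓ, hcausal, fun t x y => (iInf_le _ 0).trans (hle 0 t x y), fun t x y => ?_, hduh,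
    add_conv_heat_left hW hΓ hcomm hduh⟩
  rcases le_or_gt t 0 with ht | ht
  · simp [heat_of_nonpos ht]
  -- Truncating W only decreases S, so the same constant C serves every n.
  · refine le_iInf fun n => exp_neg_mul_heat_le_schr (measurable_trunc hW n) (trunc_le W n) ht x y ?_
    refine le_trans ?_ (hC t ht x y)
    unfold bridge
    gcongr
    exact conv_mono (fun z => min_le_left _ _) (fun _ _ _ => le_rfl) (fun _ _ _ => le_rfl) t x y

/-- The absorption rate `-V`, with values in `[0, ∞]`. -/
def rate (V : 𝔼 → ℝ) (z : 𝔼) : ℝ≥0∞ := ENNReal.ofReal (-V z)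

/-- Extension by `0` to nonpositive times of the positive part of a kernel. -/
def posKernel (G : ℝ → 𝔼 → 𝔼 → ℝ) (t : ℝ) (x y : 𝔼) : ℝ≥0∞ :=
  if 0 < t then ENNReal.ofReal (G t x y) else 0

variable {V : EuclideanSpace ℝ (Fin d) → ℝ}
  {G : ℝ → EuclideanSpace ℝ (Fin d) → EuclideanSpace ℝ (Fin d) → ℝ}

theorem measurable_rate (hV : Measurable V) : Measurable (rate V) := hV.neg.ennreal_ofReal

theorem causal_posKernel (G : ℝ → 𝔼 → 𝔼 → ℝ) : Causal (posKernel G) :=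
  fun _ ht _ _ => if_neg ht.not_gt

theorem posKernel_of_pos {t : ℝ} (ht : 0 < t) (x y : 𝔼) :
    posKernel G t x y = ENNReal.ofReal (G t x y) := if_pos ht

theorem measurableKernel_posKernel
    (h : Measurable (fun p : Ioi (0 : ℝ) × 𝔼 × 𝔼 => G p.1 p.2.1 p.2.2)) :
    MeasurableKernel (posKernel G) := by
  have hs : MeasurableSet {p : ℝ × 𝔼 × 𝔼 | 0 < p.1} :=
    measurableSet_lt measurable_const measurable_fst
  refine measurable_of_restrict_of_restrict_compl hs ?_ ?_
  · have h1 : Measurable (fun p : {p : ℝ × 𝔼 × 𝔼 | 0 < p.1} =>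
        ENNReal.ofReal (G p.1.1 p.1.2.1 p.1.2.2)) :=
      (h.comp (g := fun p : Ioi (0 : ℝ) × 𝔼 × 𝔼 => G p.1 p.2.1 p.2.2)
        (f := fun p : {p : ℝ × 𝔼 × 𝔼 | 0 < p.1} => (⟨p.1.1, p.2⟩, p.1.2))
        ((measurable_fst.comp measurable_subtype_coe).subtype_mk.prodMk
          (measurable_snd.comp measurable_subtype_coe))).ennreal_ofReal
    convert h1 using 1
    funext p
    exact posKernel_of_pos p.2 _ _
  · convert (measurable_const : Measurable fun _ : ({p : ℝ × 𝔼 × 𝔼 | 0 < p.1}ᶜ : Set _) =>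
      (0 : ℝ≥0∞)) using 1
    funext p
    exact causal_posKernel G _ (not_lt.1 p.2) _ _

/-- Because V ≤ 0, the positive part of G produces the negative part of the Duhamel integrand. -/
theorem conv_rate_posKernel (hV : ∀ z, V z ≤ 0) (G : ℝ → 𝔼 → 𝔼 → ℝ) (t : ℝ) (x y : 𝔼) :
    conv (rate V) (posKernel G) heat t x y =
      ∫⁻ p : ℝ × 𝔼 in Ioo 0 t ×ˢ univ,
        ENNReal.ofReal (-(G p.1 x p.2 * V p.2 * gaussKernel (t - p.1) p.2 y)) := by
  rw [conv_eq_setLIntegral (causal_posKernel G) causal_heat]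
  refine setLIntegral_congr_fun (measurableSet_Ioo.prod MeasurableSet.univ) fun p hp => ?_
  have h1 : 0 < p.1 := hp.1.1
  have h2 : 0 < t - p.1 := sub_pos.2 hp.1.2
  rw [posKernel_of_pos h1, heat_of_pos h2, rate, mul_assoc,
    ← ENNReal.ofReal_mul (neg_nonneg.2 (hV _)),
    ← ENNReal.ofReal_mul' (mul_nonneg (neg_nonneg.2 (hV _)) (gaussKernel_pos h2 _ _).le)]
  congr 1
  ring

theorem setIntegral_Ioo_prod_univ {f : ℝ × 𝔼 → ℝ} {t : ℝ}
    (hf : IntegrableOn f (Ioo 0 t ×ˢ univ)) :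
    ∫ p in Ioo 0 t ×ˢ univ, f p = ∫ s in Ioo 0 t, ∫ z : 𝔼, f (s, z) := by
  have h := setIntegral_prod (μ := (volume : Measure ℝ)) (ν := (volume : Measure 𝔼)) f hf
  simp only [Measure.restrict_univ] at h
  exact h

/-- Duhamel's formula in terms of the positive and the negative part. -/
theorem IsFundamentalSolution.posKernel_add (h : IsFundamentalSolution V G) (hV : ∀ z, V z ≤ 0)
    (t : ℝ) (x y : 𝔼) :
    conv (rate V) (posKernel G) heat t x y ≠ ∞ ∧
    conv (rate V) (posKernel (fun t x y => -G t x y)) heat t x y ≠ ∞ ∧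
    posKernel G t x y + conv (rate V) (posKernel G) heat t x y =
      heat t x y + posKernel (fun t x y => -G t x y) t x y +
        conv (rate V) (posKernel (fun t x y => -G t x y)) heat t x y := by
  rcases le_or_gt t 0 with ht | ht
  · simp [(causal_posKernel _).conv causal_heat t ht, causal_posKernel _ t ht, causal_heat t ht]
  have hi := h.integrable t ht x y
  have hfin1 : conv (rate V) (posKernel G) heat t x y ≠ ∞ := by
    rw [conv_rate_posKernel hV]
    exact (Integrable.lintegral_lt_top hi.neg).ne
  have hfin2 : conv (rate V) (posKernel (fun t x y => -G t x y)) heat t x y ≠ ∞ := by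
    rw [conv_rate_posKernel hV]
    simp only [neg_mul, neg_neg]
    exact (Integrable.lintegral_lt_top hi).ne
  refine ⟨hfin1, hfin2, ?_⟩
  have hd := h.duhamel t ht x y
  rw [← setIntegral_Ioo_prod_univ (f := fun p : ℝ × 𝔼 =>
      G p.1 x p.2 * V p.2 * gaussKernel (t - p.1) p.2 y) hi,
    integral_eq_lintegral_pos_part_sub_lintegral_neg_part hi,
    ← conv_rate_posKernel hV G] at hd
  have e : ∫⁻ p : ℝ × 𝔼 in Ioo 0 t ×ˢ univ,
      ENNReal.ofReal (G p.1 x p.2 * V p.2 * gaussKernel (t - p.1) p.2 y) =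
      conv (rate V) (posKernel (fun t x y => -G t x y)) heat t x y := by
    rw [conv_rate_posKernel hV]
    simp only [neg_mul, neg_neg]
  rw [e] at hd
  rw [posKernel_of_pos ht, posKernel_of_pos ht, heat_of_pos ht,
    ← ENNReal.toReal_eq_toReal_iff' (by finiteness) (by finiteness),
    ENNReal.toReal_add ENNReal.ofReal_ne_top hfin1, ENNReal.toReal_add (by finiteness) hfin2,
    ENNReal.toReal_add ENNReal.ofReal_ne_top ENNReal.ofReal_ne_top,
    ENNReal.toReal_ofReal (gaussKernel_pos ht x y).le, ENNReal.toReal_ofReal',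
    ENNReal.toReal_ofReal']
  have : max (G t x y) 0 - max (-G t x y) 0 = G t x y := by
    rcases le_total (G t x y) 0 with h' | h'
    · rw [max_eq_right h', max_eq_left (by linarith)]; ring
    · rw [max_eq_left h', max_eq_right (by linarith)]; ring
  linarith

/-- Solutions of Duhamel's formula with values in `[0, ∞]` give fundamental solutions. -/
theorem isFundamentalSolution_toReal (hVm : Measurable V) (hV : ∀ z, V z ≤ 0)
    {Γ : ℝ → 𝔼 → 𝔼 → ℝ≥0∞} (hΓm : MeasurableKernel Γ) (hc : Causal Γ)
    (hΓ : ∀ t x y, Γ t x y + conv (rate V) Γ heat t x y = heat t x y) :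
    IsFundamentalSolution V (fun t x y => (Γ t x y).toReal) := by
  have hne : ∀ t x y, Γ t x y ≠ ∞ := fun t x y =>
    ne_top_of_le_ne_top (heat_ne_top t x y) (le_self_add.trans (hΓ t x y).le)
  have hne' : ∀ t x y, conv (rate V) Γ heat t x y ≠ ∞ := fun t x y =>
    ne_top_of_le_ne_top (heat_ne_top t x y) (le_add_self.trans (hΓ t x y).le)
  have hmeas := measurable_rate hVm
  have heq : ∀ t : ℝ, ∀ x y : 𝔼, EqOn
      (fun p : ℝ × 𝔼 => (Γ p.1 x p.2).toReal * V p.2 * gaussKernel (t - p.1) p.2 y)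
      (fun p : ℝ × 𝔼 => -(Γ p.1 x p.2 * rate V p.2 * heat (t - p.1) p.2 y).toReal)
      (Ioo 0 t ×ˢ univ) := by
    intro t x y p hp
    have h2 : 0 < t - p.1 := sub_pos.2 hp.1.2
    simp only [ENNReal.toReal_mul, rate, heat_of_pos h2]
    rw [ENNReal.toReal_ofReal (by linarith [hV p.2]),
      ENNReal.toReal_ofReal (gaussKernel_pos h2 _ _).le]
    ring
  have hint : ∀ t : ℝ, ∀ x y : 𝔼, IntegrableOn
      (fun p : ℝ × 𝔼 => (Γ p.1 x p.2).toReal * V p.2 * gaussKernel (t - p.1) p.2 y)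
      (Ioo 0 t ×ˢ univ) := by
    intro t x y
    rw [integrableOn_congr_fun (heq t x y) (measurableSet_Ioo.prod MeasurableSet.univ)]
    refine (integrable_toReal_of_lintegral_ne_top
      (measurable_conv_integrand hmeas hΓm measurableKernel_heat t x y).aemeasurable ?_).neg
    rw [← conv_eq_setLIntegral hc causal_heat]
    exact hne' t x y
  refine ⟨?_, fun t _ x y => hint t x y, fun t ht x y => ?_⟩
  · exact (hΓm.comp (measurable_subtype_coe.comp measurable_fst)
      (measurable_fst.comp measurable_snd) (measurable_snd.comp measurable_snd)).ennreal_toReal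
  · rw [← setIntegral_Ioo_prod_univ (hint t x y),
      setIntegral_congr_fun (measurableSet_Ioo.prod MeasurableSet.univ) (heq t x y),
      integral_neg, integral_toReal
        (measurable_conv_integrand hmeas hΓm measurableKernel_heat t x y).aemeasurable
        (ae_of_all _ fun p => by
          have := hne p.1 x p.2
          have := heat_ne_top (t - p.1) p.2 y
          unfold rate
          finiteness),
      ← conv_eq_setLIntegral hc causal_heat]
    have h := congrArg ENNReal.toReal (hΓ t x y)
    rw [ENNReal.toReal_add (hne t x y) (hne' t x y), heat_of_pos ht,
      ENNReal.toReal_ofReal (gaussKernel_pos ht x y).le] at h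
    linarith

/-- Sharp Gaussian bounds of a fundamental solution bound `S(V)`. -/
theorem IsFundamentalSolution.bridge_le (h : IsFundamentalSolution V G) (hV : ∀ z, V z ≤ 0)
    (hG : SharpGaussianBounds G) :
    ∃ C : ℝ≥0, ∀ t > 0, ∀ x y, bridge (rate V) t x y ≤ C := by
  obtain ⟨c₁, c₂, hc₁, -, -, hb⟩ := hG
  have hlow : ∀ t > 0, ∀ x y, c₁ * gaussKernel t x y ≤ G t x y := fun t ht x y =>
    (le_div_iff₀ (gaussKernel_pos ht x y)).1 (hb t ht x y).1
  have hneg : ∀ t x y, posKernel (fun t x y => -G t x y) t x y = 0 := by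
    intro t x y
    rcases le_or_gt t 0 with ht | ht
    · exact causal_posKernel _ t ht x y
    · rw [posKernel_of_pos ht, ENNReal.ofReal_eq_zero]
      have := hlow t ht x y
      have := mul_pos hc₁ (gaussKernel_pos ht x y)
      linarith
  -- Only the lower Gaussian bound enters: it makes G positive and gives c₁ g W g ≤ G W g ≤ g.
  refine ⟨c₁⁻¹.toNNReal, fun t ht x y => (bridge_le_iff ht x y _).2 ?_⟩
  have h1 := (h.posKernel_add hV t x y).2.2
  have h2 : conv (rate V) (posKernel (fun t x y => -G t x y)) heat t x y = 0 := by
    unfold conv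
    simp [hneg]
  rw [hneg, h2, add_zero, add_zero] at h1
  have h3 : conv (rate V) (posKernel G) heat t x y ≤ heat t x y := le_add_self.trans h1.le
  have h4 : ENNReal.ofReal c₁ * conv (rate V) heat heat t x y ≤
      conv (rate V) (posKernel G) heat t x y := by
    unfold conv
    rw [← lintegral_const_mul' _ _ ENNReal.ofReal_ne_top]
    refine lintegral_mono fun p => ?_
    rw [mul_assoc, ← mul_assoc, mul_assoc (posKernel G _ _ _)]
    gcongr
    rcases le_or_gt p.1 0 with hp | hp
    · simp [heat_of_nonpos hp]
    · rw [heat_of_pos hp, posKernel_of_pos hp, ← ENNReal.ofReal_mul hc₁.le]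
      exact ENNReal.ofReal_le_ofReal (hlow _ hp _ _)
  have hc : (c₁⁻¹.toNNReal : ℝ≥0∞) = (ENNReal.ofReal c₁)⁻¹ :=
    ENNReal.ofReal_inv_of_pos hc₁
  rw [hc, mul_comm, ← div_eq_mul_inv,
    ENNReal.le_div_iff_mul_le (Or.inl (by simpa using hc₁)) (Or.inl ENNReal.ofReal_ne_top), mul_comm]
  exact h4.trans h3

theorem sharpGaussianBounds_of_le {c : ℝ} (hc : 0 < c) (hc1 : c ≤ 1)
    (h1 : ∀ t > 0, ∀ x y, c * gaussKernel t x y ≤ G t x y)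
    (h2 : ∀ t > 0, ∀ x y, G t x y ≤ gaussKernel t x y) : SharpGaussianBounds G := by
  refine ⟨c, 1, hc, hc1, le_rfl, fun t ht x y => ⟨?_, ?_⟩⟩
  · exact (le_div_iff₀ (gaussKernel_pos ht x y)).2 (h1 t ht x y)
  · exact (div_le_one (gaussKernel_pos ht x y)).2 (h2 t ht x y)

/-- If `S(V)` is bounded, then fundamental solutions exist, and each of them has sharp Gaussian
bounds. -/
theorem fundamentalSolution_of_bridge_le (hVm : Measurable V) (hV : ∀ z, V z ≤ 0)
    (hC : ∃ C : ℝ≥0, ∀ t > 0, ∀ x y, bridge (rate V) t x y ≤ C) :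
    (∃ G, IsFundamentalSolution V G) ∧
      ∀ G, IsFundamentalSolution V G → SharpGaussianBounds G := by
  obtain ⟨C, hC⟩ := hC
  have hW := measurable_rate hVm
  obtain ⟨Γ, hΓm, hc, hle, hge, hr, hl⟩ :=
    exists_schr_of_bridge_le hW (fun z => ENNReal.ofReal_ne_top) hC
  refine ⟨⟨_, isFundamentalSolution_toReal hVm hV hΓm hc hr⟩, fun G hG => ?_⟩
  have hP := measurableKernel_posKernel hG.measurable
  have hN := measurableKernel_posKernel (G := fun t x y => -G t x y) hG.measurable.neg
  -- A fundamental solution may change sign, so uniqueness is applied to the nonnegative kernels G⁺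
  -- and Γ + G⁻. The difference G⁺ - G⁻ is then Γ.
  have huniq : ∀ t x y, posKernel G t x y = Γ t x y + posKernel (fun t x y => -G t x y) t x y := by
    refine eq_of_add_conv_eq hW hP (hΓm.add hN) hΓm hl (fun t x y => ?_)
      (fun t x y => (hG.posKernel_add hV t x y).1)
    rw [conv_add_left hW hΓm measurableKernel_heat, (hG.posKernel_add hV t x y).2.2, ← hr t x y]
    ring
  have hG' : ∀ t > 0, ∀ x y, G t x y = (Γ t x y).toReal := by
    intro t ht x y
    have h := huniq t x y
    have hne : Γ t x y ≠ ∞ := ne_top_of_le_ne_top (heat_ne_top t x y) (hle t x y)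
    rw [posKernel_of_pos ht, posKernel_of_pos ht] at h
    have h' := congrArg ENNReal.toReal h
    rw [ENNReal.toReal_add hne ENNReal.ofReal_ne_top, ENNReal.toReal_ofReal',
      ENNReal.toReal_ofReal'] at h'
    have h0 : 0 ≤ (Γ t x y).toReal := ENNReal.toReal_nonneg
    rcases le_total (G t x y) 0 with h' | h'
    · rw [max_eq_right h', max_eq_left (by linarith)] at *
      linarith
    · rw [max_eq_left h', max_eq_right (by linarith)] at *
      linarith
  refine sharpGaussianBounds_of_le (Real.exp_pos (-C)) (Real.exp_le_one_iff.2 (by simp))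
    (fun t ht x y => ?_) (fun t ht x y => ?_)
  · rw [hG' t ht]
    have hne : Γ t x y ≠ ∞ := ne_top_of_le_ne_top (heat_ne_top t x y) (hle t x y)
    refine (ENNReal.ofReal_le_iff_le_toReal hne).1 ?_
    rw [ENNReal.ofReal_mul (Real.exp_pos _).le, ← heat_of_pos ht]
    exact hge t x y
  · rw [hG' t ht]
    refine ENNReal.toReal_le_of_le_ofReal (gaussKernel_pos ht x y).le ?_
    rw [← heat_of_pos ht]
    exact hle t x y

end

/-! ### The radial integral and its comparison with K -/

section

/-- The density `(4πs)^{-p} exp(-(a - sb)² / (4s))`. -/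
def radial (p a b s : ℝ) : ℝ :=
  (4 * Real.pi * s) ^ (-p) * Real.exp (-((a - s * b) ^ 2 / (4 * s)))

theorem measurable_radial (p a b : ℝ) : Measurable (radial p a b) := by
  unfold radial; fun_prop

theorem lower_rpow_identity (p : ℝ) {a r : ℝ} (ha : 0 < a) (hr : 0 < r) :
    (8 * Real.pi * (a ^ 2 / r ^ 2)) ^ (-p) * (a ^ 2 / r ^ 3) =
      (8 * Real.pi) ^ (-p) * ((a ^ (2 * p - 2))⁻¹ * (r ^ 2) ^ (p - 3 / 2)) := by
  have hpi := Real.pi_pos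
  obtain ⟨α, rfl⟩ : ∃ α, Real.exp α = a := ⟨Real.log a, Real.exp_log ha⟩
  obtain ⟨ρ, rfl⟩ : ∃ ρ, Real.exp ρ = r := ⟨Real.log r, Real.exp_log hr⟩
  rw [Real.mul_rpow (by positivity) (by positivity), mul_assoc]
  congr 1
  simp only [← Real.exp_nat_mul, ← Real.exp_sub, ← Real.exp_mul, ← Real.exp_neg, ← Real.exp_add]
  congr 1
  push_cast
  ring

/-- With r² = 1 + ab, the point s₀ = a²/r² interpolates between the scales a² (small ab) and a/b
(large ab). On a window of length δ = a²/r³ after s₀ one has (a - sb)² ≤ s ≤ 2s₀, so the integrand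
is at least (8πs₀)^{-p} e^{-1/4}; multiplying by δ gives the claim. -/
theorem le_lintegral_radial {p a b : ℝ} (hp : 0 ≤ p) (ha : 0 < a) (hb : 0 ≤ b) :
    ENNReal.ofReal (Real.exp (-(1 / 4)) * (8 * Real.pi) ^ (-p) *
      ((a ^ (2 * p - 2))⁻¹ * (1 + a * b) ^ (p - 3 / 2))) ≤
      ∫⁻ s in Ioi 0, ENNReal.ofReal (radial p a b s) := by
  have hpi := Real.pi_pos
  set r : ℝ := √(1 + a * b) with hr_def
  have hab : 0 ≤ a * b := by positivity
  have hr2 : r ^ 2 = 1 + a * b := Real.sq_sqrt (by positivity)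
  have hr1 : 1 ≤ r := Real.one_le_sqrt.2 (by linarith)
  have hr : 0 < r := by linarith
  set s₀ : ℝ := a ^ 2 / r ^ 2 with hs₀_def
  set δ : ℝ := a ^ 2 / r ^ 3 with hδ_def
  have hs₀ : 0 < s₀ := by positivity
  have hδ : 0 < δ := by positivity
  have hδs : δ ≤ s₀ := by
    rw [hδ_def, hs₀_def]
    gcongr
    norm_num
  have hbound : ∀ s ∈ Ioc s₀ (s₀ + δ),
      (8 * Real.pi * s₀) ^ (-p) * Real.exp (-(1 / 4)) ≤ radial p a b s := by
    intro s hs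
    have hs0 : 0 < s := hs₀.trans hs.1
    unfold radial
    have h1 : (a - s * b) ^ 2 ≤ s := by
      have e1 : a - s₀ * b = a / r ^ 2 := by
        rw [hs₀_def]
        field_simp
        rw [hr2]
        ring
      have e2 : δ * b ≤ a / r := by
        have : δ * b = (a / r ^ 3) * (r ^ 2 - 1) := by
          rw [hδ_def, hr2]
          ring
        rw [this, div_mul_eq_mul_div, div_le_div_iff₀ (by positivity) hr]
        have : a * (r ^ 2 - 1) * r = a * r ^ 3 - a * r := by ring
        rw [this]
        have : 0 < a * r := by positivity
        linarith
      have e3 : a / r ^ 2 ≤ a / r := by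
        gcongr
        nlinarith
      have e4 : s₀ = (a / r) ^ 2 := by rw [hs₀_def, div_pow]
      have h2 : (s - s₀) * b ≤ δ * b := by
        gcongr
        linarith [hs.2]
      have h3 : 0 ≤ (s - s₀) * b := mul_nonneg (by linarith [hs.1]) hb
      have h4 : a - s * b = a / r ^ 2 - (s - s₀) * b := by linarith
      have h5 : 0 < a / r ^ 2 := by positivity
      have h6 : |a - s * b| ≤ a / r := by
        rw [h4, abs_le]
        constructor <;> linarith
      calc (a - s * b) ^ 2 = |a - s * b| ^ 2 := (sq_abs _).symm
        _ ≤ (a / r) ^ 2 := by gcongr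
        _ ≤ s := by rw [← e4]; exact hs.1.le
    have h2 : (a - s * b) ^ 2 / (4 * s) ≤ 1 / 4 := by
      rw [div_le_div_iff₀ (by positivity) (by norm_num)]
      linarith
    have h3 : (8 * Real.pi * s₀) ^ (-p) ≤ (4 * Real.pi * s) ^ (-p) := by
      refine Real.rpow_le_rpow_of_nonpos (by positivity) ?_ (by linarith)
      nlinarith [hs.2]
    gcongr
  calc _ = ENNReal.ofReal ((8 * Real.pi * s₀) ^ (-p) * Real.exp (-(1 / 4))) *
        volume (Ioc s₀ (s₀ + δ)) := by
        rw [Real.volume_Ioc, add_sub_cancel_left, ← ENNReal.ofReal_mul (by positivity), ← hr2,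
          mul_assoc, ← lower_rpow_identity p ha hr]
        congr 1
        ring
    _ = ∫⁻ _ in Ioc s₀ (s₀ + δ), ENNReal.ofReal
          ((8 * Real.pi * s₀) ^ (-p) * Real.exp (-(1 / 4))) := (setLIntegral_const _ _).symm
    _ ≤ ∫⁻ s in Ioc s₀ (s₀ + δ), ENNReal.ofReal (radial p a b s) :=
        setLIntegral_mono (measurable_radial p a b).ennreal_ofReal fun s hs =>
          ENNReal.ofReal_le_ofReal (hbound s hs)
    _ ≤ _ := lintegral_mono_set fun s hs => hs₀.trans hs.1

theorem rpow_mul_exp_neg_le {p u : ℝ} (hp : 0 < p) (hu : 0 ≤ u) :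
    u ^ p * Real.exp (-(u / 16)) ≤ (16 * p) ^ p := by
  have h1 : u / (16 * p) ≤ Real.exp (u / (16 * p)) :=
    le_trans (by linarith) (Real.add_one_le_exp _)
  have h2 := Real.rpow_le_rpow (by positivity) h1 hp.le
  rw [Real.div_rpow hu (by positivity), ← Real.exp_mul, div_le_iff₀ (by positivity)] at h2
  rw [Real.exp_neg, ← div_eq_mul_inv, div_le_iff₀ (Real.exp_pos _), mul_comm]
  refine h2.trans (le_of_eq ?_)
  congr 2
  field_simp

theorem lintegral_exp_neg_sq_div_four :
    ∫⁻ u : ℝ, ENNReal.ofReal (Real.exp (-(u ^ 2 / 4))) = ENNReal.ofReal (√(4 * Real.pi)) := by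
  have e : ∀ u : ℝ, Real.exp (-(u ^ 2 / 4)) = Real.exp (-(1 / 4) * u ^ 2) := fun u => by
    congr 1; ring
  simp_rw [e]
  rw [← ofReal_integral_eq_lintegral_ofReal (integrable_exp_neg_mul_sq (by norm_num))
    (ae_of_all _ fun u => (Real.exp_pos _).le), integral_gaussian]
  congr 2
  ring

/-- An inverse Gaussian integral. -/
theorem lintegral_inverse_gaussian_le {a b : ℝ} (ha : 0 < a) (hb : 0 ≤ b) :
    ∫⁻ s in Ioi 0, ENNReal.ofReal (s ^ (-(3 / 2) : ℝ) * Real.exp (-((a - s * b) ^ 2 / (4 * s)))) ≤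
      ENNReal.ofReal (2 / a * √(4 * Real.pi)) := by
  -- Substitute u = a s^{-1/2} - b s^{1/2}, strictly decreasing with u² = (a - sb)²/s. Its
  -- derivative has modulus at least (a/2) s^{-3/2}, whence the factor 2/a and a full Gaussian
  -- integral.
  set f : ℝ → ℝ := fun s => a * s ^ (-(1 / 2) : ℝ) - b * s ^ (1 / 2 : ℝ) with hf
  set f' : ℝ → ℝ := fun s => a * (-(1 / 2) * s ^ (-(1 / 2) - 1 : ℝ)) -
    b * (1 / 2 * s ^ (1 / 2 - 1 : ℝ)) with hf'
  have hderiv : ∀ s ∈ Ioi (0 : ℝ), HasDerivWithinAt f (f' s) (Ioi 0) s := by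
    intro s hs
    exact (((Real.hasDerivAt_rpow_const (Or.inl (ne_of_gt hs))).const_mul a).sub
      ((Real.hasDerivAt_rpow_const (Or.inl (ne_of_gt hs))).const_mul b)).hasDerivWithinAt
  have hanti : StrictAntiOn f (Ioi 0) := by
    intro s hs t ht hst
    have h1 : t ^ (-(1 / 2) : ℝ) < s ^ (-(1 / 2) : ℝ) :=
      Real.rpow_lt_rpow_of_neg hs hst (by norm_num)
    have h2 : s ^ (1 / 2 : ℝ) ≤ t ^ (1 / 2 : ℝ) :=
      Real.rpow_le_rpow (le_of_lt hs) hst.le (by norm_num)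
    have h3 := mul_lt_mul_of_pos_left h1 ha
    have h4 := mul_le_mul_of_nonneg_left h2 hb
    simp only [hf]
    linarith
  have hsq : ∀ s : ℝ, 0 < s → f s ^ 2 / 4 = (a - s * b) ^ 2 / (4 * s) := by
    intro s hs
    obtain ⟨ρ, rfl⟩ : ∃ ρ, Real.exp ρ = s := ⟨Real.log s, Real.exp_log hs⟩
    have h1 : Real.exp (ρ * (-(1 / 2))) = (Real.exp (ρ * (1 / 2)))⁻¹ := by
      rw [← Real.exp_neg]
      congr 1
      ring
    have h2 : Real.exp ρ = Real.exp (ρ * (1 / 2)) ^ 2 := by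
      rw [← Real.exp_nat_mul]
      congr 1
      push_cast
      ring
    simp only [hf, ← Real.exp_mul]
    rw [h1, h2]
    have := Real.exp_pos (ρ * (1 / 2))
    field_simp
  calc _ ≤ ∫⁻ s in Ioi 0, ENNReal.ofReal (2 / a) *
        (ENNReal.ofReal |f' s| * ENNReal.ofReal (Real.exp (-(f s ^ 2 / 4)))) := by
        refine setLIntegral_mono_ae' measurableSet_Ioi (ae_of_all _ fun s hs => ?_)
        have hs0 : (0 : ℝ) < s := hs
        rw [← ENNReal.ofReal_mul (abs_nonneg _), ← ENNReal.ofReal_mul (by positivity), hsq s hs0,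
          ← mul_assoc]
        refine ENNReal.ofReal_le_ofReal (mul_le_mul_of_nonneg_right ?_ (Real.exp_pos _).le)
        have e1 : (-(1 / 2) - 1 : ℝ) = -(3 / 2) := by norm_num
        have h1 : a * (1 / 2 * s ^ (-(3 / 2) : ℝ)) ≤ |f' s| := by
          refine le_trans ?_ (neg_le_abs _)
          simp only [hf', e1]
          have : 0 ≤ b * (1 / 2 * s ^ (1 / 2 - 1 : ℝ)) := by positivity
          linarith
        have h2 := mul_le_mul_of_nonneg_left h1 (show 0 ≤ 2 / a by positivity)
        refine le_trans (le_of_eq ?_) h2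
        field_simp
    _ = ENNReal.ofReal (2 / a) *
        ∫⁻ u in f '' Ioi 0, ENNReal.ofReal (Real.exp (-(u ^ 2 / 4))) := by
        rw [lintegral_const_mul' _ _ ENNReal.ofReal_ne_top,
          lintegral_image_eq_lintegral_abs_deriv_mul measurableSet_Ioi hderiv hanti.injOn]
    _ ≤ ENNReal.ofReal (2 / a) * ∫⁻ u : ℝ, ENNReal.ofReal (Real.exp (-(u ^ 2 / 4))) := by
        gcongr
        exact Measure.restrict_le_self
    _ = _ := by
        rw [lintegral_exp_neg_sq_div_four, ← ENNReal.ofReal_mul (by positivity)]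

theorem lintegral_Ioi_rpow {p c : ℝ} (hp : 1 < p) (hc : 0 < c) :
    ∫⁻ s in Ioi c, ENNReal.ofReal (s ^ (-p)) = ENNReal.ofReal (c ^ (1 - p) / (p - 1)) := by
  rw [← ofReal_integral_eq_lintegral_ofReal (integrableOn_Ioi_rpow_of_lt (by linarith) hc),
    integral_Ioi_rpow_of_lt (by linarith) hc]
  · congr 1
    rw [show -p + 1 = -(p - 1) by ring, show 1 - p = -(p - 1) by ring, neg_div_neg_eq]
  · filter_upwards [ae_restrict_mem measurableSet_Ioi] with s hs
    exact Real.rpow_nonneg (hc.le.trans (le_of_lt hs)) _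

theorem radial_le_rpow_mul {p a b s : ℝ} (hp : 0 ≤ p) (hs : 0 < s) :
    radial p a b s ≤ s ^ (-p) * Real.exp (-((a - s * b) ^ 2 / (4 * s))) := by
  unfold radial
  gcongr ?_ * _
  refine Real.rpow_le_rpow_of_nonpos hs ?_ (by linarith)
  nlinarith [Real.pi_gt_three]

theorem upper_rpow_identity (p : ℝ) {a b : ℝ} (ha : 0 < a) (hb : 0 < b) :
    (2 * b / a) ^ (p - 3 / 2) * (2 / a * √(4 * Real.pi)) =
      2 * √(4 * Real.pi) * 2 ^ (p - 3 / 2) *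
        ((a ^ (2 * p - 2))⁻¹ * (a * b) ^ (p - 3 / 2)) := by
  obtain ⟨α, rfl⟩ : ∃ α, Real.exp α = a := ⟨Real.log a, Real.exp_log ha⟩
  obtain ⟨β, rfl⟩ : ∃ β, Real.exp β = b := ⟨Real.log b, Real.exp_log hb⟩
  rw [mul_div_assoc, Real.mul_rpow (by positivity) (by positivity)]
  have h : (Real.exp β / Real.exp α) ^ (p - 3 / 2) * (Real.exp α)⁻¹ =
      (Real.exp α ^ (2 * p - 2))⁻¹ * (Real.exp α * Real.exp β) ^ (p - 3 / 2) := by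
    simp only [← Real.exp_sub, ← Real.exp_mul, ← Real.exp_neg, ← Real.exp_add]
    congr 1
    ring
  rw [← h]
  ring

/-- Here a - sb ≥ a/2, so the exponential is at most e^{-a²/(16s)}, which absorbs the power in
s^{-p} = a^{-2p} (a²/s)^p. -/
theorem radial_le_of_le_sq {p a b s : ℝ} (hp : 0 < p) (ha : 0 < a) (hs : 0 < s)
    (h : 2 * (s * b) ≤ a) : radial p a b s ≤ (16 * p) ^ p * a ^ (-(2 * p)) := by
  have h1 : a ^ 2 / s / 16 ≤ (a - s * b) ^ 2 / (4 * s) := by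
    rw [div_div, div_le_div_iff₀ (by positivity) (by positivity)]
    have : (a / 2) ^ 2 ≤ (a - s * b) ^ 2 := by
      gcongr
      linarith
    nlinarith
  have h2 := rpow_mul_exp_neg_le hp (show 0 ≤ a ^ 2 / s by positivity)
  have h3 : s ^ (-p) = a ^ (-(2 * p)) * (a ^ 2 / s) ^ p := by
    obtain ⟨α, rfl⟩ : ∃ α, Real.exp α = a := ⟨Real.log a, Real.exp_log ha⟩
    obtain ⟨ρ, rfl⟩ : ∃ ρ, Real.exp ρ = s := ⟨Real.log s, Real.exp_log hs⟩
    simp only [← Real.exp_nat_mul, ← Real.exp_sub, ← Real.exp_mul, ← Real.exp_add]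
    congr 1
    push_cast
    ring
  calc radial p a b s ≤ s ^ (-p) * Real.exp (-((a - s * b) ^ 2 / (4 * s))) :=
        radial_le_rpow_mul hp.le hs
    _ ≤ s ^ (-p) * Real.exp (-(a ^ 2 / s / 16)) := by gcongr
    _ = a ^ (-(2 * p)) * ((a ^ 2 / s) ^ p * Real.exp (-(a ^ 2 / s / 16))) := by rw [h3]; ring
    _ ≤ a ^ (-(2 * p)) * (16 * p) ^ p := by gcongr
    _ = _ := mul_comm _ _

/-- Since 1/s ≤ 2b/a, the surplus power s^{-(p-3/2)} is bounded by a constant, leaving an inverse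
Gaussian integrand. This is where p ≥ 3/2, that is d ≥ 3, is used. -/
theorem radial_le_of_le {p a b s : ℝ} (hp : 3 / 2 ≤ p) (ha : 0 < a) (_hb : 0 < b) (hs : 0 < s)
    (h : a ≤ 2 * (s * b)) : radial p a b s ≤ (2 * b / a) ^ (p - 3 / 2) *
      (s ^ (-(3 / 2) : ℝ) * Real.exp (-((a - s * b) ^ 2 / (4 * s)))) := by
  refine (radial_le_rpow_mul (by linarith) hs).trans ?_
  rw [← mul_assoc]
  gcongr
  have h1 : s ^ (-p) = s⁻¹ ^ (p - 3 / 2) * s ^ (-(3 / 2) : ℝ) := by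
    rw [Real.inv_rpow hs.le, ← Real.rpow_neg hs.le, ← Real.rpow_add hs]
    congr 1
    ring
  rw [h1]
  gcongr
  rw [inv_eq_one_div, div_le_div_iff₀ hs ha]
  linarith

/-- The constant of the upper bound for the radial integral. -/
def radialConst (p : ℝ) : ℝ :=
  (16 * p) ^ p + 1 / (p - 1) + 2 * √(4 * Real.pi) * 2 ^ (p - 3 / 2)

theorem radialConst_pos {p : ℝ} (hp : 3 / 2 ≤ p) : 0 < radialConst p := by
  unfold radialConst
  have : 0 < p - 1 := by linarith
  positivity

/-- Three regimes. If 2sb ≤ a and s ≤ a², the integrand is of order at most a^{-2p} on an interval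
of length a²; for s > a² the tail of s^{-p} suffices; both give a^{2-2p}. If 2sb ≥ a, the inverse
Gaussian integral gives a^{2-2p} (ab)^{p-3/2}. -/
theorem lintegral_radial_le {p a b : ℝ} (hp : 3 / 2 ≤ p) (ha : 0 < a) (hb : 0 ≤ b) :
    ∫⁻ s in Ioi 0, ENNReal.ofReal (radial p a b s) ≤
      ENNReal.ofReal (radialConst p * ((a ^ (2 * p - 2))⁻¹ * (1 + a * b) ^ (p - 3 / 2))) := by
  have hpi := Real.pi_pos
  have hp1 : 0 < p - 1 := by linarith
  set K₁ : ℝ := (16 * p) ^ p * a ^ (-(2 * p)) with hK₁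
  set φ₃ : ℝ → ℝ := fun s => (2 * b / a) ^ (p - 3 / 2) *
      (s ^ (-(3 / 2) : ℝ) * Real.exp (-((a - s * b) ^ 2 / (4 * s)))) with hφ₃
  set P : ℝ := (a ^ (2 * p - 2))⁻¹ * (1 + a * b) ^ (p - 3 / 2) with hP
  have h1ab : 1 ≤ 1 + a * b := by
    have : 0 ≤ a * b := by positivity
    linarith
  have hPge : (a ^ (2 * p - 2))⁻¹ ≤ P :=
    le_mul_of_one_le_right (by positivity) (Real.one_le_rpow h1ab (by linarith))
  have hP0 : 0 ≤ P := by positivity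
  have i1 : ∫⁻ s in Ioi 0, (Iic (a ^ 2)).indicator (fun _ => ENNReal.ofReal K₁) s ≤
      ENNReal.ofReal ((16 * p) ^ p * P) := by
    rw [setLIntegral_indicator measurableSet_Iic, inter_comm, Ioi_inter_Iic, setLIntegral_const,
      Real.volume_Ioc, sub_zero, ← ENNReal.ofReal_mul (by positivity)]
    refine ENNReal.ofReal_le_ofReal ?_
    have : K₁ * a ^ 2 = (16 * p) ^ p * (a ^ (2 * p - 2))⁻¹ := by
      rw [hK₁, mul_assoc, ← Real.rpow_natCast, ← Real.rpow_add ha, ← Real.rpow_neg ha.le]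
      congr 2
      push_cast
      ring
    rw [this]
    gcongr
  have i2 : ∫⁻ s in Ioi 0, (Ioi (a ^ 2)).indicator (fun s => ENNReal.ofReal (s ^ (-p))) s ≤
      ENNReal.ofReal (1 / (p - 1) * P) := by
    rw [setLIntegral_indicator measurableSet_Ioi, Ioi_inter_Ioi, sup_of_le_left (by positivity),
      lintegral_Ioi_rpow (by linarith) (by positivity)]
    refine ENNReal.ofReal_le_ofReal ?_
    have : (a ^ 2) ^ (1 - p) = (a ^ (2 * p - 2))⁻¹ := by
      rw [← Real.rpow_natCast, ← Real.rpow_mul ha.le, ← Real.rpow_neg ha.le]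
      congr 1
      push_cast
      ring
    rw [this, div_eq_inv_mul, ← one_div]
    gcongr
  -- For b = 0 the third regime is empty; the guard discards a term that would otherwise survive
  -- when p = 3/2, since 0^0 = 1.
  have i3 : ∫⁻ s in Ioi 0, (if 0 < b then ENNReal.ofReal (φ₃ s) else 0) ≤
      ENNReal.ofReal (2 * √(4 * Real.pi) * 2 ^ (p - 3 / 2) * P) := by
    split_ifs with hb0
    · simp only [hφ₃]
      simp_rw [ENNReal.ofReal_mul (show 0 ≤ (2 * b / a) ^ (p - 3 / 2) by positivity)]
      rw [lintegral_const_mul' _ _ ENNReal.ofReal_ne_top]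
      refine (mul_le_mul_right (lintegral_inverse_gaussian_le ha hb) _).trans ?_
      rw [← ENNReal.ofReal_mul (by positivity), upper_rpow_identity p ha hb0]
      refine ENNReal.ofReal_le_ofReal ?_
      rw [hP]
      gcongr
      linarith
    · simp
  calc _ ≤ ∫⁻ s in Ioi 0, ((Iic (a ^ 2)).indicator (fun _ => ENNReal.ofReal K₁) s +
        (Ioi (a ^ 2)).indicator (fun s => ENNReal.ofReal (s ^ (-p))) s +
        (if 0 < b then ENNReal.ofReal (φ₃ s) else 0)) := by
        refine setLIntegral_mono_ae' measurableSet_Ioi (ae_of_all _ fun s hs => ?_)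
        have hs0 : (0 : ℝ) < s := hs
        rcases le_total (2 * (s * b)) a with h | h
        · rcases le_or_gt s (a ^ 2) with h' | h'
          · rw [indicator_of_mem (show s ∈ Iic (a ^ 2) from h'), add_assoc]
            exact le_trans (ENNReal.ofReal_le_ofReal
              (radial_le_of_le_sq (by linarith) ha hs0 h)) le_self_add
          · rw [indicator_of_mem (show s ∈ Ioi (a ^ 2) from h')]
            refine le_trans (ENNReal.ofReal_le_ofReal ?_) (le_add_self.trans le_self_add)
            refine (radial_le_rpow_mul (by linarith) hs0).trans
              (mul_le_of_le_one_right (by positivity) (Real.exp_le_one_iff.2 ?_))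
            have : 0 ≤ (a - s * b) ^ 2 / (4 * s) := by positivity
            linarith
        · have hb0 : 0 < b := by
            by_contra hb'
            have : b = 0 := le_antisymm (not_lt.1 hb') hb
            rw [this] at h
            linarith
          rw [if_pos hb0]
          exact le_trans (ENNReal.ofReal_le_ofReal (radial_le_of_le hp ha hb0 hs0 h)) le_add_self
    _ ≤ ENNReal.ofReal ((16 * p) ^ p * P) + ENNReal.ofReal (1 / (p - 1) * P) +
        ENNReal.ofReal (2 * √(4 * Real.pi) * 2 ^ (p - 3 / 2) * P) := by
        rw [lintegral_add_left, lintegral_add_left]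
        · gcongr
        · exact measurable_const.indicator measurableSet_Iic
        · refine (measurable_const.indicator measurableSet_Iic).add
            (Measurable.indicator ?_ measurableSet_Ioi)
          fun_prop
    _ = _ := by
        rw [← ENNReal.ofReal_add (by positivity) (by positivity),
          ← ENNReal.ofReal_add (by positivity) (by positivity), radialConst]
        congr 1
        ring

/-- Comparing |w - sξ|² with (|w| - s|ξ|)² leaves 2s(|w||ξ| - w·ξ). After division by 4s this is
independent of s and is exactly the exponent in K. -/
theorem gaussKernel_smul_eq {s : ℝ} (hs : 0 < s) (w ξ : 𝔼) :
    gaussKernel s (s • ξ) w = Real.exp (-((‖w‖ * ‖ξ‖ - inner ℝ w ξ) / 2)) *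
      radial ((d : ℝ) / 2) ‖w‖ ‖ξ‖ s := by
  have h : ‖w - s • ξ‖ ^ 2 / (4 * s) =
      (‖w‖ * ‖ξ‖ - inner ℝ w ξ) / 2 + (‖w‖ - s * ‖ξ‖) ^ 2 / (4 * s) := by
    rw [norm_sub_sq_real, inner_smul_right, norm_smul, Real.norm_of_nonneg hs.le]
    field_simp
    ring
  unfold gaussKernel radial
  rw [h, neg_add, Real.exp_add]
  ring

theorem kernelK_eq (w ξ : 𝔼) : kernelK w ξ = Real.exp (-((‖w‖ * ‖ξ‖ - inner ℝ w ξ) / 2)) *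
    ((‖w‖ ^ (2 * ((d : ℝ) / 2) - 2))⁻¹ * (1 + ‖w‖ * ‖ξ‖) ^ ((d : ℝ) / 2 - 3 / 2)) := by
  unfold kernelK
  rw [mul_div_cancel₀ _ two_ne_zero]
  ring

theorem lintegral_gaussKernel_smul (w ξ : 𝔼) :
    ∫⁻ s in Ioi 0, ENNReal.ofReal (gaussKernel s (s • ξ) w) =
      ENNReal.ofReal (Real.exp (-((‖w‖ * ‖ξ‖ - inner ℝ w ξ) / 2))) *
        ∫⁻ s in Ioi 0, ENNReal.ofReal (radial ((d : ℝ) / 2) ‖w‖ ‖ξ‖ s) := by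
  rw [← lintegral_const_mul' _ _ ENNReal.ofReal_ne_top]
  refine setLIntegral_congr_fun measurableSet_Ioi fun s hs => ?_
  rw [← ENNReal.ofReal_mul (Real.exp_pos _).le, gaussKernel_smul_eq hs]

theorem lintegral_gaussKernel_smul_le (hd : 3 ≤ d) {w : 𝔼} (hw : w ≠ 0) (ξ : 𝔼) :
    ∫⁻ s in Ioi 0, ENNReal.ofReal (gaussKernel s (s • ξ) w) ≤
      ENNReal.ofReal (radialConst ((d : ℝ) / 2)) * ENNReal.ofReal (kernelK w ξ) := by
  have hd' : (3 : ℝ) ≤ d := by exact_mod_cast hd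
  have hp : (3 / 2 : ℝ) ≤ (d : ℝ) / 2 := by linarith
  rw [lintegral_gaussKernel_smul, ← ENNReal.ofReal_mul (radialConst_pos hp).le, kernelK_eq,
    mul_left_comm, ENNReal.ofReal_mul (Real.exp_pos _).le]
  gcongr
  exact lintegral_radial_le hp (norm_pos_iff.2 hw) (norm_nonneg _)

theorem le_lintegral_gaussKernel_smul {w : 𝔼} (hw : w ≠ 0) (ξ : 𝔼) :
    ENNReal.ofReal (Real.exp (-(1 / 4)) * (8 * Real.pi) ^ (-((d : ℝ) / 2))) *
      ENNReal.ofReal (kernelK w ξ) ≤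
      ∫⁻ s in Ioi 0, ENNReal.ofReal (gaussKernel s (s • ξ) w) := by
  have hpi := Real.pi_pos
  rw [lintegral_gaussKernel_smul, ← ENNReal.ofReal_mul (by positivity), kernelK_eq,
    mul_left_comm, ENNReal.ofReal_mul (Real.exp_pos _).le]
  gcongr
  exact le_lintegral_radial (by positivity) (norm_pos_iff.2 hw) (norm_nonneg _)

end

/-! ### Bridge potential, moving Gaussians and K -/

section

variable {W : EuclideanSpace ℝ (Fin d) → ℝ≥0∞} {V : EuclideanSpace ℝ (Fin d) → ℝ}

theorem gaussKernel_add_right (s : ℝ) (x c z : 𝔼) :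
    gaussKernel s (x + c) z = gaussKernel s c (z - x) := by
  unfold gaussKernel
  rw [sub_add_eq_sub_sub]

/-- For `s ≤ t / 2` the bridge density is comparable with the Gaussian density along the line. -/
theorem heat_mul_heat_le {s t : ℝ} (hs : 0 < s) (hst : 2 * s ≤ t) (x y z : 𝔼) :
    heat s x z * heat (t - s) z y ≤ heat t x y * (ENNReal.ofReal (2 ^ ((d : ℝ) / 2)) *
      ENNReal.ofReal (gaussKernel s (s • (t⁻¹ • (y - x))) (z - x))) := by
  have hpi := Real.pi_pos
  have ht : 0 < t := by linarith
  have hts : 0 < t - s := by linarith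
  rw [heat_of_pos hs, heat_of_pos hts, heat_of_pos ht,
    ← ENNReal.ofReal_mul (gaussKernel_pos hs _ _).le, ← ENNReal.ofReal_mul (by positivity),
    ← ENNReal.ofReal_mul (gaussKernel_pos ht _ _).le, gaussKernel_mul_gaussKernel hs hts,
    add_sub_cancel, gaussKernel_add_right, smul_smul, ← div_eq_mul_inv]
  refine ENNReal.ofReal_le_ofReal (mul_le_mul_of_nonneg_left ?_ (gaussKernel_pos ht _ _).le)
  -- The bridge variance parameter v = s(t-s)/t lies in [s/2, s] when 2s ≤ t: v ≤ s compares the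
  -- exponentials, and v ≥ s/2 costs the factor 2^{d/2}.
  set v : ℝ := s * (t - s) / t with hv_def
  have hv : 0 < v := by positivity
  have hvs : v ≤ s := by
    rw [hv_def, div_le_iff₀ ht]
    nlinarith
  have hsv : s ≤ 2 * v := by
    rw [hv_def, ← mul_div_assoc, le_div_iff₀ ht]
    nlinarith
  unfold gaussKernel
  rw [← mul_assoc]
  have h1 : (4 * Real.pi * v) ^ (-((d : ℝ) / 2)) ≤
      2 ^ ((d : ℝ) / 2) * (4 * Real.pi * s) ^ (-((d : ℝ) / 2)) := by
    have h2 : (2 : ℝ) ^ ((d : ℝ) / 2) = (1 / 2 : ℝ) ^ (-((d : ℝ) / 2)) := by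
      rw [Real.rpow_neg (by norm_num), one_div, Real.inv_rpow (by norm_num), inv_inv]
    rw [h2, ← Real.mul_rpow (by norm_num) (by positivity)]
    refine Real.rpow_le_rpow_of_nonpos (by positivity) ?_ (by
      have : (0 : ℝ) ≤ (d : ℝ) / 2 := by positivity
      linarith)
    nlinarith
  gcongr

/-- The potential of the absorption rate along the Gaussian densities moving with speed `ξ`. -/
def drift (W : 𝔼 → ℝ≥0∞) (x ξ : 𝔼) : ℝ≥0∞ :=
  ∫⁻ z : 𝔼, W z * ∫⁻ s in Ioi 0, ENNReal.ofReal (gaussKernel s (s • ξ) (z - x))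

theorem measurable_gaussKernel_drift (x ξ : 𝔼) :
    Measurable (fun p : ℝ × 𝔼 => ENNReal.ofReal (gaussKernel p.1 (p.1 • ξ) (p.2 - x))) := by
  unfold gaussKernel
  fun_prop

theorem drift_eq (hW : Measurable W) (x ξ : 𝔼) :
    drift W x ξ = ∫⁻ s in Ioi 0, ∫⁻ z : 𝔼,
      W z * ENNReal.ofReal (gaussKernel s (s • ξ) (z - x)) := by
  have hm := measurable_gaussKernel_drift x ξ
  unfold drift
  rw [lintegral_lintegral_swap]
  · refine lintegral_congr fun z => ?_
    rw [lintegral_const_mul]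
    exact hm.comp (measurable_id.prodMk measurable_const)
  · exact ((hW.comp measurable_snd).mul hm).aemeasurable

theorem lintegral_half_le (hW : Measurable W) {t : ℝ} (x y : 𝔼) :
    ∫⁻ s in Ioc 0 (t / 2), ∫⁻ z, heat s x z * W z * heat (t - s) z y ≤
      ENNReal.ofReal (2 ^ ((d : ℝ) / 2)) * drift W x (t⁻¹ • (y - x)) * heat t x y := by
  set K : ℝ≥0∞ := heat t x y * ENNReal.ofReal (2 ^ ((d : ℝ) / 2)) with hK
  have hK' : K ≠ ∞ := ENNReal.mul_ne_top (heat_ne_top t x y) ENNReal.ofReal_ne_top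
  calc _ ≤ ∫⁻ s in Ioc 0 (t / 2), K * ∫⁻ z,
        W z * ENNReal.ofReal (gaussKernel s (s • (t⁻¹ • (y - x))) (z - x)) := by
        refine setLIntegral_mono_ae' measurableSet_Ioc (ae_of_all _ fun s hs => ?_)
        rw [← lintegral_const_mul' _ _ hK']
        refine lintegral_mono fun z => ?_
        have h := mul_le_mul_right (heat_mul_heat_le hs.1 (show 2 * s ≤ t by linarith [hs.2]) x y z)
          (W z)
        calc _ = W z * (heat s x z * heat (t - s) z y) := by ring
          _ ≤ _ := h
          _ = _ := by rw [hK]; ring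
    _ = K * ∫⁻ s in Ioc 0 (t / 2), ∫⁻ z,
        W z * ENNReal.ofReal (gaussKernel s (s • (t⁻¹ • (y - x))) (z - x)) :=
        lintegral_const_mul' _ _ hK'
    _ ≤ K * drift W x (t⁻¹ • (y - x)) := by
        rw [drift_eq hW]
        gcongr
        exact Ioc_subset_Ioi_self
    _ = _ := by rw [hK]; ring

/-- Split the bridge at time t/2. Reversing time makes the second half a first half started at y,
with velocity (x - y)/t. -/
theorem bridge_le_drift (hW : Measurable W) {t : ℝ} (ht : 0 < t) (x y : 𝔼) :
    bridge W t x y ≤ ENNReal.ofReal (2 ^ ((d : ℝ) / 2)) *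
      (drift W x (t⁻¹ • (y - x)) + drift W y (t⁻¹ • (x - y))) := by
  rw [bridge_le_iff ht]
  have hg := measurableKernel_heat (d := d)
  set F : ℝ → ℝ≥0∞ := fun s => ∫⁻ z, heat s x z * W z * heat (t - s) z y with hF
  have hFm : Measurable F :=
    Measurable.lintegral_prod_right' (measurable_conv_integrand hW hg hg t x y)
  have h0 : ∀ s, s ∉ Ioc 0 (t / 2) → s ∉ Ico (t / 2) t → F s = 0 := by
    intro s h1 h2
    refine (lintegral_congr fun z => ?_).trans lintegral_zero
    rcases le_or_gt s 0 with h | h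
    · simp [heat_of_nonpos h]
    · have h3 : t / 2 < s := by
        by_contra h3
        exact h1 ⟨h, not_lt.1 h3⟩
      have h4 : t ≤ s := by
        by_contra h4
        exact h2 ⟨h3.le, not_le.1 h4⟩
      simp [heat_of_nonpos (show t - s ≤ 0 by linarith)]
  have h1 : ∫⁻ s, F s ≤ (∫⁻ s in Ioc 0 (t / 2), F s) + ∫⁻ s in Ico (t / 2) t, F s := by
    rw [← lintegral_indicator measurableSet_Ioc, ← lintegral_indicator measurableSet_Ico,
      ← lintegral_add_left (hFm.indicator measurableSet_Ioc)]
    refine lintegral_mono fun s => ?_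
    by_cases h1 : s ∈ Ioc 0 (t / 2)
    · rw [indicator_of_mem h1]
      exact le_self_add
    · by_cases h2 : s ∈ Ico (t / 2) t
      · rw [indicator_of_mem h2]
        exact le_add_self
      · simp [h0 s h1 h2]
  have h2 : ∫⁻ s in Ico (t / 2) t, F s =
      ∫⁻ s in Ioc 0 (t / 2), ∫⁻ z, heat s y z * W z * heat (t - s) z x := by
    have hmp := (Measure.measurePreserving_sub_left (volume : Measure ℝ) t)
    rw [← lintegral_indicator measurableSet_Ioc, ← lintegral_indicator measurableSet_Ico,
      ← hmp.lintegral_comp (hFm.indicator measurableSet_Ico)]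
    refine lintegral_congr fun s => ?_
    have hiff : t - s ∈ Ico (t / 2) t ↔ s ∈ Ioc 0 (t / 2) := by
      simp only [mem_Ico, mem_Ioc]
      constructor <;> rintro ⟨h1, h2⟩ <;> constructor <;> linarith
    by_cases hs : s ∈ Ioc 0 (t / 2)
    · rw [indicator_of_mem hs, indicator_of_mem (hiff.2 hs)]
      refine lintegral_congr fun z => ?_
      rw [sub_sub_cancel, heat_comm s, heat_comm (t - s)]
      ring
    · rw [indicator_of_notMem hs, indicator_of_notMem (fun h => hs (hiff.1 h))]
  rw [conv_eq_lintegral_lintegral hW hg hg, mul_add, add_mul]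
  refine h1.trans (add_le_add (lintegral_half_le hW x y) ?_)
  rw [h2, heat_comm t x y]
  exact lintegral_half_le hW y x

/-- Along `y = x + t ξ` the bridge densities converge to the Gaussian densities moving with
speed `ξ`. -/
theorem tendsto_bridge_density {s : ℝ} (hs : 0 < s) (x ξ z : 𝔼) :
    Filter.Tendsto (fun n : ℕ => heat s x z * heat (n - s) z (x + (n : ℝ) • ξ) /
      heat n x (x + (n : ℝ) • ξ)) Filter.atTop
      (nhds (ENNReal.ofReal (gaussKernel s (s • ξ) (z - x)))) := by
  have hpi := Real.pi_pos
  -- The bridge to x + nξ has mean exactly x + sξ at time s; only its variance parameter s(1 - s/n)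
  -- depends on n.
  have h1 : ∀ᶠ n : ℕ in Filter.atTop, ENNReal.ofReal
      (gaussKernel (s * (1 - s * (n : ℝ)⁻¹)) (s • ξ) (z - x)) =
      heat s x z * heat (n - s) z (x + (n : ℝ) • ξ) / heat n x (x + (n : ℝ) • ξ) := by
    obtain ⟨N, hN⟩ := exists_nat_gt s
    filter_upwards [Filter.eventually_ge_atTop N] with n hn
    have hn' : s < n := hN.trans_le (by exact_mod_cast hn)
    have hn0 : (0 : ℝ) < n := hs.trans hn'
    have hns : (0 : ℝ) < n - s := by linarith
    rw [heat_of_pos hs, heat_of_pos hns, heat_of_pos hn0,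
      ← ENNReal.ofReal_mul (gaussKernel_pos hs _ _).le, gaussKernel_mul_gaussKernel hs hns,
      add_sub_cancel, ← ENNReal.ofReal_div_of_pos (gaussKernel_pos hn0 _ _),
      mul_div_cancel_left₀ _ (gaussKernel_pos hn0 _ _).ne', add_sub_cancel_left, smul_smul,
      div_mul_cancel₀ _ hn0.ne', gaussKernel_add_right]
    congr 2
    field_simp
  refine Filter.Tendsto.congr' h1 (ENNReal.tendsto_ofReal ?_)
  have h2 : Filter.Tendsto (fun n : ℕ => s * (1 - s * (n : ℝ)⁻¹)) Filter.atTop (nhds s) := by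
    simpa using ((tendsto_inv_atTop_nhds_zero_nat (𝕜 := ℝ)).const_mul s |>.const_sub 1
      |>.const_mul s)
  have h3 : ContinuousAt (fun v : ℝ => gaussKernel v (s • ξ) (z - x)) s := by
    unfold gaussKernel
    refine ContinuousAt.mul (ContinuousAt.rpow_const (by fun_prop) (Or.inl (by positivity))) ?_
    refine (ContinuousAt.neg (ContinuousAt.div (by fun_prop) (by fun_prop) (by positivity))).rexp
  exact h3.tendsto.comp h2

/-- Fatou's lemma along t = n and y = x + nξ, where the bridge densities converge pointwise to the
moving Gaussian. -/
theorem drift_le_of_bridge_le (hW : Measurable W) {C : ℝ≥0∞}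
    (hC : ∀ t > 0, ∀ x y, bridge W t x y ≤ C) (x ξ : 𝔼) : drift W x ξ ≤ C := by
  have hg := measurableKernel_heat (d := d)
  set Φ : ℕ → ℝ × 𝔼 → ℝ≥0∞ := fun n p =>
    heat p.1 x p.2 * W p.2 * heat (n - p.1) p.2 (x + (n : ℝ) • ξ) / heat n x (x + (n : ℝ) • ξ)
    with hΦ
  have hΦm : ∀ n, Measurable (Φ n) := fun n =>
    (measurable_conv_integrand hW hg hg n x _).div measurable_const
  have hΦle : ∀ n : ℕ, 0 < n → ∫⁻ p, Φ n p ≤ C := by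
    intro n hn
    have hn0 : (0 : ℝ) < n := by exact_mod_cast hn
    refine le_trans (le_of_eq ?_) (hC n hn0 x (x + (n : ℝ) • ξ))
    simp only [hΦ, div_eq_mul_inv]
    rw [lintegral_mul_const _ (measurable_conv_integrand hW hg hg n x _)]
    rfl
  have hlim : ∀ p : ℝ × 𝔼, (if 0 < p.1 then
      W p.2 * ENNReal.ofReal (gaussKernel p.1 (p.1 • ξ) (p.2 - x)) else 0) ≤
      Filter.liminf (fun n => Φ n p) Filter.atTop := by
    intro p
    split_ifs with hp
    -- W may be infinite here; multiplying the limit by it is legitimate because the limiting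
    -- Gaussian density is nonzero.
    · have h1 := ENNReal.Tendsto.const_mul (a := W p.2) (tendsto_bridge_density hp x ξ p.2)
        (Or.inl (by simpa using gaussKernel_pos hp _ _))
      rw [← h1.liminf_eq]
      refine le_of_eq (congrArg (fun u => Filter.liminf u Filter.atTop) ?_)
      funext n
      simp only [hΦ, div_eq_mul_inv]
      ring
    · exact zero_le
  have hm := measurable_gaussKernel_drift x ξ
  calc drift W x ξ = ∫⁻ p : ℝ × 𝔼, (if 0 < p.1 then
      W p.2 * ENNReal.ofReal (gaussKernel p.1 (p.1 • ξ) (p.2 - x)) else 0) := by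
        have hm' : Measurable (fun p : ℝ × 𝔼 => if 0 < p.1 then
            W p.2 * ENNReal.ofReal (gaussKernel p.1 (p.1 • ξ) (p.2 - x)) else 0) :=
          Measurable.ite (measurableSet_lt measurable_const measurable_fst)
            ((hW.comp measurable_snd).mul hm) measurable_const
        rw [drift_eq hW, ← lintegral_indicator measurableSet_Ioi]
        refine Eq.trans ?_ (lintegral_prod _ hm'.aemeasurable).symm
        refine lintegral_congr fun s => ?_
        by_cases hs : 0 < s
        · simp [hs]
        · simp [hs]
    _ ≤ ∫⁻ p, Filter.liminf (fun n => Φ n p) Filter.atTop := lintegral_mono hlim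
    _ ≤ Filter.liminf (fun n => ∫⁻ p, Φ n p) Filter.atTop := lintegral_liminf_le hΦm
    _ ≤ C := by
        refine Filter.liminf_le_of_frequently_le' (Filter.Eventually.frequently ?_)
        filter_upwards [Filter.eventually_gt_atTop 0] with n hn
        exact hΦle n hn

/-- At w = 0 the formula for K takes the default value 0 of division by zero, while the time
integral of the moving Gaussian diverges. The comparison therefore has to omit this null set. -/
theorem ae_sub_ne_zero (hd : 3 ≤ d) (x : 𝔼) : ∀ᵐ z : 𝔼, z - x ≠ 0 := by
  have : Nonempty (Fin d) := ⟨⟨0, by omega⟩⟩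
  have h : ∀ᵐ z : 𝔼, z ≠ x := by
    rw [ae_iff]
    simp
  filter_upwards [h] with z hz
  exact sub_ne_zero.2 hz

theorem potentialK_eq (hV : ∀ z, V z ≤ 0) (x ξ : 𝔼) :
    potentialK V x ξ = ∫⁻ z : 𝔼, rate V z * ENNReal.ofReal (kernelK (z - x) ξ) := by
  unfold potentialK rate
  refine lintegral_congr fun z => ?_
  rw [abs_of_nonpos (hV z), ENNReal.ofReal_mul (by linarith [hV z])]

theorem drift_le_potentialK (hd : 3 ≤ d) (hV : ∀ z, V z ≤ 0) (x ξ : 𝔼) :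
    drift (rate V) x ξ ≤ ENNReal.ofReal (radialConst ((d : ℝ) / 2)) * potentialK V x ξ := by
  rw [potentialK_eq hV, ← lintegral_const_mul' _ _ ENNReal.ofReal_ne_top]
  refine lintegral_mono_ae ?_
  filter_upwards [ae_sub_ne_zero hd x] with z hz
  rw [mul_left_comm]
  gcongr
  exact lintegral_gaussKernel_smul_le hd hz ξ

theorem potentialK_le_drift (hd : 3 ≤ d) (hV : ∀ z, V z ≤ 0) (x ξ : 𝔼) :
    ENNReal.ofReal (Real.exp (-(1 / 4)) * (8 * Real.pi) ^ (-((d : ℝ) / 2))) * potentialK V x ξ ≤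
      drift (rate V) x ξ := by
  rw [potentialK_eq hV, ← lintegral_const_mul' _ _ ENNReal.ofReal_ne_top]
  refine lintegral_mono_ae ?_
  filter_upwards [ae_sub_ne_zero hd x] with z hz
  rw [mul_left_comm]
  gcongr
  exact le_lintegral_gaussKernel_smul hz ξ

/-- `S(V)` is bounded if and only if `K(V)` is bounded. -/
theorem exists_bridge_le_iff_boundedK (hd : 3 ≤ d) (hVm : Measurable V) (hV : ∀ z, V z ≤ 0) :
    (∃ C : ℝ≥0, ∀ t > 0, ∀ x y, bridge (rate V) t x y ≤ C) ↔ BoundedK V := by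
  have hW := measurable_rate hVm
  have hpi := Real.pi_pos
  constructor
  · rintro ⟨C, hC⟩
    set κ : ℝ≥0∞ := ENNReal.ofReal (Real.exp (-(1 / 4)) * (8 * Real.pi) ^ (-((d : ℝ) / 2)))
      with hκ
    have hκ0 : κ ≠ 0 := by
      rw [hκ, Ne, ENNReal.ofReal_eq_zero, not_le]
      positivity
    have hκt : κ ≠ ∞ := ENNReal.ofReal_ne_top
    refine lt_of_le_of_lt (iSup_le fun x => iSup_le fun ξ => ?_)
      (ENNReal.div_lt_top ENNReal.coe_ne_top hκ0 : (C : ℝ≥0∞) / κ < ∞)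
    rw [ENNReal.le_div_iff_mul_le (Or.inl hκ0) (Or.inl hκt), mul_comm]
    exact (potentialK_le_drift hd hV x ξ).trans (drift_le_of_bridge_le hW hC x ξ)
  · intro hK
    set K : ℝ≥0∞ := ⨆ x : 𝔼, ⨆ ξ : 𝔼, potentialK V x ξ with hK_def
    have hKt : K ≠ ∞ := ne_of_lt hK
    set C : ℝ≥0∞ := ENNReal.ofReal (2 ^ ((d : ℝ) / 2)) *
      (ENNReal.ofReal (radialConst ((d : ℝ) / 2)) * K +
        ENNReal.ofReal (radialConst ((d : ℝ) / 2)) * K) with hC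
    have hCt : C ≠ ∞ := by
      rw [hC]
      finiteness
    refine ⟨C.toNNReal, fun t ht x y => ?_⟩
    rw [ENNReal.coe_toNNReal hCt]
    refine (bridge_le_drift hW ht x y).trans ?_
    have h : ∀ x ξ : 𝔼, drift (rate V) x ξ ≤ ENNReal.ofReal (radialConst ((d : ℝ) / 2)) * K := by
      intro x ξ
      refine (drift_le_potentialK hd hV x ξ).trans ?_
      gcongr
      exact le_iSup₂ (f := fun x ξ => potentialK V x ξ) x ξ
    rw [hC]
    gcongr
    · exact h _ _
    · exact h _ _

end

end SchrodingerBounds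

end

theorem mainTheorem4 (d : ℕ) (hd : 3 ≤ d) (V : EuclideanSpace ℝ (Fin d) → ℝ)
    (hVmeas : Measurable V) (hV : ∀ z, V z ≤ 0) :
    ((∃ G : ℝ → EuclideanSpace ℝ (Fin d) → EuclideanSpace ℝ (Fin d) → ℝ,
        SchrodingerBounds.IsFundamentalSolution V G ∧ SchrodingerBounds.SharpGaussianBounds G)
      ↔ SchrodingerBounds.BoundedK V) ∧
    (∀ G : ℝ → EuclideanSpace ℝ (Fin d) → EuclideanSpace ℝ (Fin d) → ℝ,
      SchrodingerBounds.IsFundamentalSolution V G →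
        (SchrodingerBounds.SharpGaussianBounds G ↔ SchrodingerBounds.BoundedK V)) := by
  have hiff := SchrodingerBounds.exists_bridge_le_iff_boundedK hd hVmeas hV
  have hsol := fun h => SchrodingerBounds.fundamentalSolution_of_bridge_le hVmeas hV (hiff.2 h)
  refine ⟨⟨?_, fun h => ?_⟩, fun G hG => ⟨fun hs => hiff.1 (hG.bridge_le hV hs),
    fun h => (hsol h).2 G hG⟩⟩
  · rintro ⟨G, hG, hs⟩
    exact hiff.1 (hG.bridge_le hV hs)
  · obtain ⟨G, hG⟩ := (hsol h).1
    exact ⟨G, hG, (hsol h).2 G hG⟩
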